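/- Let $\mathbb F_q$ be a finite field with $q$ elements and $K=\mathbb F_q(t)$. A curve in $\mathbb A^n$ means an integral closed subscheme of dimension one of $\mathbb A^n_K$, and its degree is the degree of its projective closure in $\mathbb P^n_K$. For a curve $C\subseteq\mathbb A^n$ and $\ell\in\mathbb R$ let $$N(C;\ell)=\#\{x\in\mathbb F_q[t]^n : x\in C,\ \max_i\deg x_i<\ell\},\qquad \deg 0=-\infty .$$ Let $C$ be a curve in $\mathbb A^3$ of degree $d$. Then there is a curve $C'$ in $\mathbb A^2$, birational to $C$ and of the same degree $d$, such that for all $\ell\in\mathbb R$ $$N(C;\ell)\le N(C';\ell+2\log_q d)+d^2 .$$ Moreover, $C'$ can be obtained by projecting $C$ from a point at infinity of small height: there are coprime $p_1,p_2,p_3\in\mathbb F_q[t]$ with $|p_i|\le d$ for all $i$, where $|a|=q^{\deg a}$ and $|0|=0$, and a $2\times 3$ matrix $M$ over $\mathbb F_q[t]$ whose kernel on $K^3$ is the line spanned by $(p_1,p_2,p_3)$, such that $x\mapsto Mx$ restricts to a birational map from $C$ to $C'$. -/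

import Mathlib

open Polynomial Filter

noncomputable section

namespace AffineCurve

/-- The ideal `C` of `K[x_i : i ∈ σ]` is the ideal of an (integral) affine curve over `K`, that is,
of an irreducible reduced closed subscheme of dimension one of the affine space `𝔸^σ` over `K`. -/
structure IsCurve {σ K : Type*} [Field K] (C : Ideal (MvPolynomial σ K)) : Prop where
  isPrime : C.IsPrime
  dim_eq_one : ringKrullDim (MvPolynomial σ K ⧸ C) = 1

/-- The Hilbert function of the projective closure of the affine scheme `V(C)`. The forms of degree
`m` on projective space, modulo those that vanish on the closure of `V(C)`, are by dehomogenization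
the polynomials of total degree at most `m` modulo those in `C`: the value at `m` is the dimension
of the image of the space of polynomials of total degree at most `m` in the coordinate ring. -/
def hilbertFunction {σ K : Type*} [Field K] (C : Ideal (MvPolynomial σ K)) (m : ℕ) : ℕ :=
  Module.finrank K
    ((MvPolynomial.restrictTotalDegree σ K m).map (Ideal.Quotient.mkₐ K C).toLinearMap)

/-- The affine curve `C` has degree `d`: the Hilbert polynomial of its projective closure is
`d * m + c` for some constant `c`. -/
def HasDegree {σ K : Type*} [Field K] (C : Ideal (MvPolynomial σ K)) (d : ℕ) : Prop :=
  ∃ c : ℤ, ∀ᶠ m : ℕ in atTop, (hilbertFunction C m : ℤ) = d * m + c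

/-- The function field of an integral affine scheme. -/
abbrev FunctionField {σ K : Type*} [Field K] (C : Ideal (MvPolynomial σ K)) : Type _ :=
  FractionRing (MvPolynomial σ K ⧸ C)

/-- The `i`-th coordinate function, as an element of the function field. -/
def coord {σ K : Type*} [Field K] (C : Ideal (MvPolynomial σ K)) (i : σ) : FunctionField C :=
  algebraMap (MvPolynomial σ K ⧸ C) (FunctionField C) (Ideal.Quotient.mk C (MvPolynomial.X i))

/-- The linear map `x ↦ M x` restricts to a birational map from `C` to `C'`: the substitution
`y_i = ∑ j, M i j * x_j` induces an isomorphism over `K` of the function field of `C'` with that of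
`C`. (Since `C` and `C'` are prime, this includes that `C'` is the closure of the image of `C`.) -/
def IsBirationalVia {σ τ K : Type*} [Field K] [Fintype σ] (M : Matrix τ σ K)
    (C : Ideal (MvPolynomial σ K)) (C' : Ideal (MvPolynomial τ K)) : Prop :=
  ∃ e : FunctionField C' ≃ₐ[K] FunctionField C, ∀ i, e (coord C' i) = ∑ j, M i j • coord C j

/-- The logarithmic height `max_i deg x_i` of a tuple of polynomials, where `deg 0 = -∞`. -/
def logHeight {F : Type*} [Field F] {n : ℕ} (x : Fin n → F[X]) : WithBot ℕ :=
  Finset.univ.sup fun i => (x i).degree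

/-- The tuples in `F[t]^n` that lie on `V(C)` and have logarithmic height less than `ℓ`. -/
def points {F : Type*} [Field F] {n : ℕ} (C : Ideal (MvPolynomial (Fin n) (RatFunc F))) (ℓ : ℝ) :
    Set (Fin n → F[X]) :=
  {x | (∀ f ∈ C, MvPolynomial.eval (fun i => algebraMap F[X] (RatFunc F) (x i)) f = 0) ∧
    (logHeight x).map (Nat.cast : ℕ → ℝ) < (ℓ : WithBot ℝ)}

/-- The affine counting function. -/
def count {F : Type*} [Field F] {n : ℕ} (C : Ideal (MvPolynomial (Fin n) (RatFunc F))) (ℓ : ℝ) :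
    ℕ :=
  (points C ℓ).ncard

theorem logHeight_lt_iff {F : Type*} [Field F] {n : ℕ} (x : Fin n → F[X]) (ℓ : ℝ) :
    (logHeight x).map (Nat.cast : ℕ → ℝ) < (ℓ : WithBot ℝ) ↔
      ∀ i, x i = 0 ∨ ((x i).natDegree : ℝ) < ℓ := by
  have key : ∀ b : WithBot ℕ, b.map (Nat.cast : ℕ → ℝ) < (ℓ : WithBot ℝ) ↔
      b < ((⌈ℓ⌉₊ : ℕ) : WithBot ℕ) ∨ b = ⊥ := by
    intro b
    induction b using WithBot.recBotCoe with
    | bot => simp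
    | coe a =>
      rw [WithBot.map_coe, WithBot.coe_lt_coe, ← Nat.lt_ceil]
      exact ⟨fun h => Or.inl (WithBot.coe_lt_coe.2 h), fun h =>
        h.elim WithBot.coe_lt_coe.1 fun h' => (WithBot.coe_ne_bot h').elim⟩
  have key2 : ∀ i, (x i = 0 ∨ ((x i).natDegree : ℝ) < ℓ) ↔
      ((x i).degree < ((⌈ℓ⌉₊ : ℕ) : WithBot ℕ) ∨ (x i).degree = ⊥) := by
    intro i
    by_cases h : x i = 0
    · simp [h]
    · rw [Polynomial.degree_eq_natDegree h]
      simp [h, Nat.lt_ceil]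
  rw [key, logHeight]
  simp only [key2]
  by_cases hc : ⌈ℓ⌉₊ = 0
  · have h0 : ∀ b : WithBot ℕ, (b < ((⌈ℓ⌉₊ : ℕ) : WithBot ℕ) ∨ b = ⊥) ↔ b = ⊥ := by
      intro b
      rw [hc]
      induction b using WithBot.recBotCoe <;> simp
    simp only [h0]
    simp [Finset.sup_eq_bot_iff]
  · have h1 : ∀ b : WithBot ℕ, (b < ((⌈ℓ⌉₊ : ℕ) : WithBot ℕ) ∨ b = ⊥) ↔
        b < ((⌈ℓ⌉₊ : ℕ) : WithBot ℕ) := by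
      intro b
      refine ⟨?_, Or.inl⟩
      rintro (h | rfl)
      · exact h
      · exact WithBot.bot_lt_coe _
    simp only [h1]
    rw [Finset.sup_lt_iff (WithBot.bot_lt_coe _)]
    simp

/-- The counting function counts a finite set, so `Set.ncard` takes no junk value in it. -/
theorem points_finite {F : Type*} [Field F] [Finite F] {n : ℕ}
    (C : Ideal (MvPolynomial (Fin n) (RatFunc F))) (ℓ : ℝ) : (points C ℓ).Finite := by
  have hfin : {a : F[X] | a = 0 ∨ (a.natDegree : ℝ) < ℓ}.Finite := by
    have : Finite (Polynomial.degreeLT F (⌈ℓ⌉₊)) :=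
      Finite.of_equiv _ (Polynomial.degreeLTEquiv F ⌈ℓ⌉₊).symm.toEquiv
    refine Set.Finite.subset (Set.toFinite (Polynomial.degreeLT F (⌈ℓ⌉₊) : Set F[X])) ?_
    rintro a (rfl | h)
    · exact Submodule.zero_mem _
    · refine Polynomial.mem_degreeLT.2 (lt_of_le_of_lt Polynomial.degree_le_natDegree ?_)
      exact_mod_cast Nat.lt_ceil.2 h
  refine Set.Finite.subset (Set.Finite.pi' fun _ : Fin n => hfin) ?_
  intro x hx i
  exact (logHeight_lt_iff x ℓ).1 hx.2 i

/-- The linear map `𝔸³ → 𝔸²` with matrix `M` is a projection from the point `(p : 0)` of the plane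
at infinity: its kernel over the field of fractions is the line spanned by `p`. -/
def IsProjectionFrom {F : Type*} [Field F] (M : Matrix (Fin 2) (Fin 3) F[X]) (p : Fin 3 → F[X]) :
    Prop :=
  LinearMap.ker (M.map (algebraMap F[X] (RatFunc F))).mulVecLin =
    Submodule.span (RatFunc F) {fun i => algebraMap F[X] (RatFunc F) (p i)}

end AffineCurve

end

/-! Let x be the generic point of C in its function field L. Write H_x(m) for the dimension of the
space of polynomials of degree at most m in x, and H_y(m) for the same with the projected
coordinates y. Both are dimensions inside L (`degSpan`), so they can be compared.

Choice of the centre. Up to a permutation of coordinates the centre is p = (1, a, b), where a is 0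
or 1 and b ranges over more than d polynomials with |b| ≤ d. One coordinate is separable over the
field of the other two (`exists_isSeparable_adjoin_compl`); it is called x₂. Choose a so that u = x₁
- a x₀ is transcendental, and let r = [L : K(u)]. By a quantitative primitive element theorem, at
most r values of b make (u, x₂ - b x₀) fail to generate L (`card_le_finrank_of_adjoin_ne_top`). By a
Bézout count, at most d - r values of b put p on the closure of C (`card_add_finrank_le`). Some b
therefore avoids both defects (`exists_projection`).

Degree. Since p is off the closure, the projection is finite. A conductor (`exists_conductor`) then
gives H_y(m) ≤ H_x(m) ≤ H_y(m + κ), so the degree is preserved.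

Points. Passing to the image loses at most H_x(m) - H_y(m) points for large m
(`card_add_finrank_le_card_image_add`). A plane curve of degree d has H_y(m) = dm + (3d - d²)/2 for
m ≥ d, while H_x(m) ≤ d(m + 1) by `finrank_degSpan_le`. The loss is at most d(d - 1)/2. Heights grow
little because deg a and deg b are at most log_q d. -/

namespace AffineCurve

/-! ### Hilbert functions as dimensions of spaces of polynomial values. -/

section DegSpan

variable {K L σ : Type*} [Field K] [CommRing L] [Algebra K L]

/-- The space of values at `x` of the polynomials of total degree at most `m`. -/
noncomputable def degSpan (K : Type*) {L σ : Type*} [Field K] [CommRing L] [Algebra K L]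
    (x : σ → L) (m : ℕ) :
    Submodule K L :=
  (MvPolynomial.restrictTotalDegree σ K m).map (MvPolynomial.aeval x).toLinearMap

theorem mem_degSpan {x : σ → L} {m : ℕ} {z : L} :
    z ∈ degSpan K x m ↔
      ∃ g : MvPolynomial σ K, g.totalDegree ≤ m ∧ MvPolynomial.aeval x g = z := by
  simp [degSpan, MvPolynomial.mem_restrictTotalDegree]

theorem aeval_mem_degSpan {x : σ → L} {m : ℕ} {g : MvPolynomial σ K} (hg : g.totalDegree ≤ m) :
    MvPolynomial.aeval x g ∈ degSpan K x m :=
  mem_degSpan.2 ⟨g, hg, rfl⟩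

instance [Finite σ] (x : σ → L) (m : ℕ) : FiniteDimensional K (degSpan K x m) := by
  unfold degSpan; infer_instance

theorem degSpan_mono (x : σ → L) : Monotone (degSpan K x) := fun m n hmn z hz => by
  obtain ⟨g, hg, rfl⟩ := mem_degSpan.1 hz
  exact aeval_mem_degSpan (hg.trans hmn)

theorem algebraMap_mem_degSpan (x : σ → L) (m : ℕ) (a : K) :
    algebraMap K L a ∈ degSpan K x m :=
  mem_degSpan.2 ⟨MvPolynomial.C a, by simp, by simp⟩

theorem one_mem_degSpan (x : σ → L) (m : ℕ) : (1 : L) ∈ degSpan K x m := by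
  simpa using algebraMap_mem_degSpan x m (1 : K)

theorem apply_mem_degSpan (x : σ → L) (i : σ) : x i ∈ degSpan K x 1 :=
  mem_degSpan.2 ⟨MvPolynomial.X i, by simp, by simp⟩

theorem mul_mem_degSpan {x : σ → L} {m n : ℕ} {y z : L} (hy : y ∈ degSpan K x m)
    (hz : z ∈ degSpan K x n) : y * z ∈ degSpan K x (m + n) := by
  obtain ⟨g, hg, rfl⟩ := mem_degSpan.1 hy
  obtain ⟨h, hh, rfl⟩ := mem_degSpan.1 hz
  rw [← map_mul]
  exact aeval_mem_degSpan ((MvPolynomial.totalDegree_mul g h).trans (add_le_add hg hh))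

theorem pow_mem_degSpan {x : σ → L} {m : ℕ} {y : L} (hy : y ∈ degSpan K x m) (n : ℕ) :
    y ^ n ∈ degSpan K x (n * m) := by
  induction n with
  | zero => simpa using one_mem_degSpan x 0
  | succ n ih => rw [pow_succ, add_mul, one_mul]; exact mul_mem_degSpan ih hy

/-- A filtration of submodules that contains `1` and is compatible with multiplication by the `x i`
contains the filtration by `degSpan`. -/
theorem degSpan_le_of_mul_mem {x : σ → L} {U : ℕ → Submodule K L} (hU : Monotone U)
    (h1 : (1 : L) ∈ U 0) (hmul : ∀ i m z, z ∈ U m → x i * z ∈ U (m + 1)) (m : ℕ) :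
    degSpan K x m ≤ U m := by
  have key : ∀ (k : ℕ) (s : σ →₀ ℕ), (s.sum fun _ e => e) = k →
      MvPolynomial.aeval x (MvPolynomial.monomial s (1 : K)) ∈ U k := by
    intro k
    induction k with
    | zero =>
      intro s hs
      have : s = 0 := by
        ext i
        by_contra hi
        have := Finset.sum_eq_zero_iff.1 hs i (Finsupp.mem_support_iff.2 hi)
        exact hi this
      subst this
      simpa using h1
    | succ k ih =>
      intro s hs
      obtain ⟨i, hi⟩ : ∃ i, s i ≠ 0 := by
        by_contra! h
        have : s = 0 := by ext i; simpa using h i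
        simp [this] at hs
      classical
      have hsi : Finsupp.single i 1 + (s - Finsupp.single i 1) = s := by
        ext j
        rcases eq_or_ne i j with rfl | hj
        · simp; omega
        · simp [hj]
      rw [← hsi] at hs ⊢
      rw [Finsupp.sum_add_index' (fun _ => rfl) (fun _ _ _ => rfl),
        Finsupp.sum_single_index rfl] at hs
      have h2 := hmul i k _ (ih (s - Finsupp.single i 1) (by omega))
      rw [← one_mul (1 : K), ← MvPolynomial.monomial_mul, map_mul]
      have : MvPolynomial.aeval x (MvPolynomial.monomial (Finsupp.single i 1) (1 : K)) = x i := by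
        simp [MvPolynomial.aeval_monomial]
      rw [this]
      exact h2
  intro z hz
  obtain ⟨g, hg, rfl⟩ := mem_degSpan.1 hz
  rw [g.as_sum, map_sum]
  refine Submodule.sum_mem _ fun s hs => ?_
  have h2 : MvPolynomial.monomial s (g.coeff s) =
      (g.coeff s) • MvPolynomial.monomial s (1 : K) := by simp [MvPolynomial.smul_monomial]
  rw [h2, map_smul]
  exact Submodule.smul_mem _ _
    (hU ((MvPolynomial.le_totalDegree hs).trans hg) (key _ s rfl))

theorem degSpan_le_degSpan {τ : Type*} {x : σ → L} {y : τ → L}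
    (h : ∀ i, y i ∈ degSpan K x 1) (m : ℕ) : degSpan K y m ≤ degSpan K x m :=
  degSpan_le_of_mul_mem (degSpan_mono x) (one_mem_degSpan x 0)
    (fun i m z hz => by rw [add_comm]; exact mul_mem_degSpan (h i) hz) m

/-- The coordinate ring embeds in `L` as the algebra generated by `x`. This places the Hilbert
functions of a curve and of its projection inside one field. -/
theorem hilbertFunction_ker_aeval (x : σ → L) (m : ℕ) :
    hilbertFunction (RingHom.ker (MvPolynomial.aeval x : MvPolynomial σ K →ₐ[K] L)) m =
      Module.finrank K (degSpan K x m) := by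
  set φ : MvPolynomial σ K →ₐ[K] L := MvPolynomial.aeval x
  have h : degSpan K x m = ((MvPolynomial.restrictTotalDegree σ K m).map
      (Ideal.Quotient.mkₐ K (RingHom.ker φ)).toLinearMap).map
      (Ideal.kerLiftAlg φ).toLinearMap := by
    rw [← Submodule.map_comp]
    rfl
  rw [hilbertFunction, h]
  exact (LinearEquiv.finrank_eq (Submodule.equivMapOfInjective (Ideal.kerLiftAlg φ).toLinearMap
    (Ideal.kerLiftAlg_injective φ) _))

theorem ker_aeval_coord (C : Ideal (MvPolynomial σ K)) [C.IsPrime] :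
    RingHom.ker (MvPolynomial.aeval (coord C) : MvPolynomial σ K →ₐ[K] FunctionField C) = C := by
  have h : (MvPolynomial.aeval (coord C) : MvPolynomial σ K →ₐ[K] FunctionField C) =
      (IsScalarTower.toAlgHom K (MvPolynomial σ K ⧸ C) (FunctionField C)).comp
        (Ideal.Quotient.mkₐ K C) := by
    ext i
    simp [coord]
  ext g
  rw [RingHom.mem_ker, h]
  simp only [AlgHom.comp_apply, IsScalarTower.coe_toAlgHom', Ideal.Quotient.mkₐ_eq_mk,
    map_eq_zero_iff _ (IsFractionRing.injective (MvPolynomial σ K ⧸ C) (FunctionField C))]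
  exact Ideal.Quotient.eq_zero_iff_mem

theorem hilbertFunction_eq_finrank (C : Ideal (MvPolynomial σ K)) [C.IsPrime] (m : ℕ) :
    hilbertFunction C m = Module.finrank K (degSpan K (coord C) m) := by
  rw [← hilbertFunction_ker_aeval, ker_aeval_coord]

theorem finrank_restrictTotalDegree_two (K : Type*) [Field K] (m : ℕ) :
    Module.finrank K (MvPolynomial.restrictTotalDegree (Fin 2) K m) * 2 = (m + 1) * (m + 2) := by
  -- A monomial is recorded by its total degree and its exponent in the first variable.
  have e : {n : Fin 2 →₀ ℕ | (n.sum fun _ e => e) ≤ m} ≃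
      (Σ i : Fin (m + 1), Fin (i + 1)) :=
    { toFun := fun n => ⟨⟨n.1 0 + n.1 1, by
        have := n.2
        simp [Finsupp.sum_fintype] at this
        omega⟩, ⟨n.1 0, by simp⟩⟩
      invFun := fun p => ⟨Finsupp.equivFunOnFinite.symm ![p.2.1, p.1.1 - p.2.1], by
        have h1 := p.1.2
        have h2 := p.2.2
        simp [Finsupp.sum_fintype]
        omega⟩
      left_inv := fun n => by
        ext i
        fin_cases i <;> simp
      right_inv := fun p => by
        obtain ⟨⟨i, hi⟩, ⟨j, hj⟩⟩ := p
        have : j + (i - j) = i := by simp at hj; omega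
        refine Sigma.ext (Fin.ext this) ?_
        exact (Fin.heq_ext_iff (by simpa using this)).2 rfl }
  unfold MvPolynomial.restrictTotalDegree
  rw [Module.finrank_eq_nat_card_basis (MvPolynomial.basisRestrictSupport K _), Nat.card_congr e,
    Nat.card_eq_fintype_card, Fintype.card_sigma]
  simp only [Fintype.card_fin]
  rw [Fin.sum_univ_eq_sum_range (fun i => i + 1)]
  clear e
  induction m with
  | zero => simp
  | succ m ih => rw [Finset.sum_range_succ, add_mul, ih]; ring

end DegSpan

/-! ### Derivations, separability and primitive elements. -/

section Derivations

variable {E L : Type*} [Field E] [Field L] [Algebra E L]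

open IntermediateField in
theorem derivation_eq_zero_of_mem_adjoin (D : Derivation E L L) {s : Set L}
    (hs : ∀ a ∈ s, D a = 0) {z : L} (hz : z ∈ adjoin E s) : D z = 0 := by
  induction hz using adjoin_induction with
  | mem a ha => exact hs a ha
  | algebraMap a => exact D.map_algebraMap a
  | add a b _ _ ha hb => simp [ha, hb]
  | inv a _ ha => simp [D.leibniz_inv, ha]
  | mul a b _ _ ha hb => simp [ha, hb]

open IntermediateField in
/-- A derivation that vanishes on a set vanishes on the elements separable over it. -/
theorem derivation_eq_zero_of_isSeparable (D : Derivation E L L) {s : Set L}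
    (hs : ∀ a ∈ s, D a = 0) {z : L} (hz : IsSeparable (adjoin E s) z) : D z = 0 := by
  -- `D` kills the field generated by `s`, hence is linear over it and may be applied to the minimal
  -- polynomial of `z` over that field.
  let D' : Derivation (adjoin E s) L L := Derivation.mk'
    { toFun := D
      map_add' := D.map_add
      map_smul' := fun c a => by
        have := derivation_eq_zero_of_mem_adjoin D hs c.2
        rw [Algebra.smul_def, D.leibniz, IntermediateField.algebraMap_apply, this]
        simp [Algebra.smul_def] }
    (fun a b => D.leibniz a b)
  have h := D'.map_aeval (minpoly (adjoin E s) z) z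
  rw [minpoly.aeval, map_zero, smul_eq_mul] at h
  exact (mul_eq_zero.1 h.symm).resolve_left (hz.aeval_derivative_ne_zero (minpoly.aeval _ _))

/-- For extensions essentially of finite type, separable algebraic means formally unramified.
Otherwise there is a nonzero differential, and a linear form that does not kill it is a derivation.
-/
theorem exists_derivation_ne_zero [Algebra.EssFiniteType E L] (h : ¬ Algebra.IsSeparable E L) :
    ∃ D : Derivation E L L, D ≠ 0 := by
  by_contra! h0
  refine h ((Algebra.FormallyUnramified.iff_isSeparable E L).1 ⟨?_⟩)
  by_contra hΩ
  rw [not_subsingleton_iff_nontrivial] at hΩ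
  obtain ⟨ω, hω⟩ := exists_ne (0 : Ω[L⁄E])
  obtain ⟨f, hf⟩ : ∃ f : Ω[L⁄E] →ₗ[L] L, f ω ≠ 0 := by
    by_contra! hf
    exact hω ((Module.forall_dual_apply_eq_zero_iff L ω).1 hf)
  have h2 := h0 (f.compDer (KaehlerDifferential.D E L))
  have h3 : f = 0 := by
    apply (KaehlerDifferential.linearMapEquivDerivation E L).injective
    rw [map_zero]
    exact h2
  exact hf (by simp [h3])

open IntermediateField in
/-- If `L` is not separable over the subfield generated by `s`, then there is a nonzero derivation
that vanishes on `s`. -/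
theorem exists_derivation_ne_zero_of_adjoin [Algebra.EssFiniteType E L] (s : Set L)
    (h : ¬ Algebra.IsSeparable (adjoin E s) L) :
    ∃ D : Derivation E L L, D ≠ 0 ∧ ∀ a ∈ s, D a = 0 := by
  have : Algebra.EssFiniteType (adjoin E s) L := Algebra.EssFiniteType.of_comp E _ L
  obtain ⟨D, hD⟩ := exists_derivation_ne_zero h
  refine ⟨D.restrictScalars E, fun h0 => hD ?_, fun a ha => ?_⟩
  · ext a
    exact congrArg (fun D : Derivation E L L => D a) h0
  · exact D.map_algebraMap ⟨a, subset_adjoin E s ha⟩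

open IntermediateField in
/-- A quantitative form of the primitive element theorem: if `L = E(x, z)` has degree `r` over `E`
and `z` is separable over `E(x)`, then `z - b x` fails to generate `L` for at most `r` values `b`
in `E`. -/
theorem card_le_finrank_of_adjoin_ne_top [FiniteDimensional E L] (x z : L)
    (hxz : adjoin E {x, z} = ⊤) (hz : IsSeparable (adjoin E {x}) z) (S : Finset E)
    (hS : ∀ b ∈ S, adjoin E {z - algebraMap E L b * x} ≠ ⊤) : S.card ≤ Module.finrank E L := by
  classical
  set v : E → L := fun b => z - algebraMap E L b * x with hv
  have hDv : ∀ (D : Derivation E L L) (b : E), D (v b) = D z - algebraMap E L b * D x := by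
    intro D b
    simp [hv]
  have hD0 : ∀ (D : Derivation E L L), D ≠ 0 → ∀ b, D (v b) = 0 → D x ≠ 0 := by
    intro D hD b hb hx
    rw [hDv, hx, mul_zero, sub_zero] at hb
    refine hD (Derivation.ext fun a => ?_)
    refine derivation_eq_zero_of_mem_adjoin D (s := {x, z}) ?_ (hxz ▸ mem_top)
    rintro a (rfl | rfl) <;> assumption
  -- Since `z` is separable over `E(x)`, a derivation of `L` over `E` is determined by its value at
  -- `x`, so any two are proportional. The condition `D (v b) = 0` then forces b = D z / D x, a
  -- single value.
  have hins : (S.filter fun b => ¬ Algebra.IsSeparable (adjoin E {v b}) L).card ≤ 1 := by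
    refine Finset.card_le_one.2 fun b hb b' hb' => ?_
    obtain ⟨D, hD, hDb⟩ := exists_derivation_ne_zero_of_adjoin _ (Finset.mem_filter.1 hb).2
    obtain ⟨D', hD', hDb'⟩ := exists_derivation_ne_zero_of_adjoin _ (Finset.mem_filter.1 hb').2
    have h1 := hDb _ rfl
    have h2 := hDb' _ rfl
    have h3 := hD0 D hD b h1
    have h4 := hD0 D' hD' b' h2
    have h5 : (D' x • D - D x • D') z = 0 :=
      derivation_eq_zero_of_isSeparable _ (s := {x}) (by rintro a rfl; simp [mul_comm]) hz
    rw [hDv, sub_eq_zero] at h1 h2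
    simp only [Derivation.coe_sub, Derivation.coe_smul, Pi.sub_apply, Pi.smul_apply, smul_eq_mul,
      h1, h2] at h5
    have h6 : (algebraMap E L b - algebraMap E L b') * (D x * D' x) = 0 := by
      linear_combination h5
    have h7 := (mul_eq_zero.1 h6).resolve_right (mul_ne_zero h3 h4)
    exact (algebraMap E L).injective (sub_eq_zero.1 h7)
  -- If `L` is separable over `E(v b)` and larger, some embedding other than `ι` agrees with `ι` at
  -- `v b`. One that does so for two values of `b` agrees with `ι` at `x` and `z`, hence everywhere.
  -- So these embeddings are distinct; counting `ι` too gives the `+ 1`, which makes room for the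
  -- one inseparable value.
  have hsep : (S.filter fun b => Algebra.IsSeparable (adjoin E {v b}) L).card + 1 ≤
      Module.finrank E L := by
    set T := S.filter fun b => Algebra.IsSeparable (adjoin E {v b}) L with hT
    let ι : Field.Emb E L := IsScalarTower.toAlgHom E L (AlgebraicClosure L)
    have hσ : ∀ b ∈ T, ∃ σ : Field.Emb E L, σ ≠ ι ∧ σ (v b) = ι (v b) := by
      intro b hb
      obtain ⟨hbS, hb⟩ := Finset.mem_filter.1 hb
      have hr : Module.finrank (adjoin E {v b}) L ≠ 1 := fun h =>
        hS b hbS (IntermediateField.finrank_eq_one_iff_eq_top.1 h)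
      rw [← Field.finSepDegree_eq_finrank_of_isSeparable, Field.finSepDegree] at hr
      let ι' : Field.Emb (adjoin E {v b}) L :=
        IsScalarTower.toAlgHom (adjoin E {v b}) L (AlgebraicClosure L)
      obtain ⟨σ, hσ⟩ : ∃ σ : Field.Emb (adjoin E {v b}) L, σ ≠ ι' := by
        by_contra! h
        exact hr (Nat.card_eq_one_iff_exists.2 ⟨ι', h⟩)
      refine ⟨AlgHom.restrictScalars E σ, fun h => hσ ?_, ?_⟩
      · ext a
        exact congrArg (fun τ : Field.Emb E L => τ a) h
      · exact σ.commutes ⟨v b, subset_adjoin E _ rfl⟩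
    choose! σ hσ1 hσ2 using hσ
    have hinj : Set.InjOn σ T := by
      intro b hb b' hb' h
      by_contra hne
      have h1 := hσ2 b hb
      have h2 := hσ2 b' hb'
      rw [← h] at h2
      have hvv : v b - v b' = algebraMap E L (b' - b) * x := by simp [hv]; ring
      have h3 : (σ b) (algebraMap E L (b' - b) * x) = ι (algebraMap E L (b' - b) * x) := by
        rw [← hvv, map_sub (σ b) (v b), map_sub ι (v b), h1, h2]
      rw [map_mul, map_mul, AlgHom.commutes, AlgHom.commutes] at h3
      have h4 : (σ b) x = ι x := mul_left_cancel₀ (by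
        rw [Ne, FaithfulSMul.algebraMap_eq_zero_iff, sub_eq_zero]
        exact Ne.symm hne) h3
      have h5 : (σ b) z = ι z := by
        simp only [hv, map_sub, map_mul, AlgHom.commutes, h4] at h1
        exact sub_left_injective h1
      refine hσ1 b hb (AlgHom.ext fun a => ?_)
      have ha : a ∈ adjoin E {x, z} := hxz ▸ mem_top
      induction ha using adjoin_induction with
      | mem a ha => rcases ha with rfl | rfl <;> assumption
      | algebraMap a => rw [AlgHom.commutes, AlgHom.commutes]
      | add a b _ _ ha hb => rw [map_add, map_add, ha, hb]
      | inv a _ ha => rw [map_inv₀, map_inv₀, ha]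
      | mul a b _ _ ha hb => rw [map_mul, map_mul, ha, hb]
    have : Fintype (Field.Emb E L) := Fintype.ofFinite _
    have hc : (T.image σ ∪ {ι}).card = T.card + 1 := by
      rw [Finset.card_union_of_disjoint, Finset.card_image_of_injOn hinj, Finset.card_singleton]
      rw [Finset.disjoint_singleton_right, Finset.mem_image]
      rintro ⟨b, hb, h⟩
      exact hσ1 b hb h
    rw [← hc]
    refine (Finset.card_le_univ _).trans ?_
    rw [← Nat.card_eq_fintype_card]
    exact Field.finSepDegree_le_finrank E L
  have := Finset.card_filter_add_card_filter_not (s := S)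
    (fun b => Algebra.IsSeparable (adjoin E {v b}) L)
  omega

end Derivations

/-! ### Linear growth of the Hilbert function and transcendence degree one. -/

section TranscendenceDegree

universe u

variable {K L σ : Type*} [Field K] [Field L] [Algebra K L]

theorem two_mul_lt_of_eventually {d c : ℤ} : ∀ᶠ m : ℕ in atTop,
    (d * m + c) * 2 < (m + 1) * (m + 2) := by
  filter_upwards [eventually_ge_atTop (2 * d.natAbs + 2 * c.natAbs)] with m hm
  have h1 : (2 * |d| + 2 * |c| : ℤ) ≤ m := by
    have := Int.natCast_natAbs d
    have := Int.natCast_natAbs c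
    omega
  have h2 := le_abs_self d
  have h3 := le_abs_self c
  have h4 := abs_nonneg d
  have h5 := abs_nonneg c
  nlinarith

/-- Independent `y 0`, `y 1` would give a subspace of dimension (m + 1)(m + 2)/2, and quadratic
growth exceeds linear growth. -/
theorem not_algebraicIndependent_of_finrank_degSpan [Finite σ] {x : σ → L} {d c : ℤ}
    (hd : ∀ᶠ m : ℕ in atTop, (Module.finrank K (degSpan K x m) : ℤ) = d * m + c)
    (y : Fin 2 → L) (hy : ∀ i, y i ∈ degSpan K x 1) : ¬ AlgebraicIndependent K y := by
  intro h
  obtain ⟨m, hm1, hm2⟩ := (hd.and (two_mul_lt_of_eventually (d := d) (c := c))).exists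
  have h1 : Module.finrank K (degSpan K y m) * 2 = (m + 1) * (m + 2) := by
    rw [← finrank_restrictTotalDegree_two K m, degSpan]
    congr 1
    exact (LinearEquiv.finrank_eq
      (Submodule.equivMapOfInjective (MvPolynomial.aeval y).toLinearMap h _)).symm
  have h2 := Submodule.finrank_mono (degSpan_le_degSpan hy m)
  rw [← hm1] at hm2
  have h3 : ((Module.finrank K (degSpan K y m) : ℤ)) * 2 = (m + 1) * (m + 2) := by
    exact_mod_cast h1
  have h4 : (Module.finrank K (degSpan K y m) : ℤ) ≤ Module.finrank K (degSpan K x m) := by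
    exact_mod_cast h2
  linarith

/-- A transcendence basis can be chosen among the `x i`, and no two of them are algebraically
independent. -/
theorem trdeg_le_one_of_finrank_degSpan [Finite σ] {x : σ → L} {d c : ℤ}
    (hx : IntermediateField.adjoin K (Set.range x) = ⊤)
    (hd : ∀ᶠ m : ℕ in atTop, (Module.finrank K (degSpan K x m) : ℤ) = d * m + c) :
    Algebra.trdeg K L ≤ 1 := by
  have : Algebra.IsAlgebraic (Algebra.adjoin K (Set.range x)) L := by
    rw [← IntermediateField.isAlgebraic_adjoin_iff_top, hx, Algebra.isAlgebraic_iff_isIntegral]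
    exact Algebra.isIntegral_of_surjective IntermediateField.topEquiv.surjective
  obtain ⟨t, htx, ht⟩ := exists_isTranscendenceBasis_subset (R := K) (Set.range x)
  rw [← ht.cardinalMk_eq_trdeg, Cardinal.le_one_iff_subsingleton]
  refine ⟨fun a b => ?_⟩
  by_contra hab
  refine not_algebraicIndependent_of_finrank_degSpan hd ![(a : L), b] ?_ ?_
  · intro i
    obtain ⟨j, hj⟩ := htx a.2
    obtain ⟨k, hk⟩ := htx b.2
    fin_cases i
    · simpa [← hj] using apply_mem_degSpan (K := K) x j
    · simpa [← hk] using apply_mem_degSpan (K := K) x k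
  · have := ht.1.comp ![a, b] (by
      intro i j hij
      fin_cases i <;> fin_cases j <;> simp_all [eq_comm])
    convert! this using 1
    ext i
    fin_cases i <;> rfl

/-- The powers 1, u, …, u^m are linearly independent in `degSpan K x m`, so its dimension is
unbounded. -/
theorem pos_of_finrank_degSpan [Finite σ] {x : σ → L} {d c : ℤ}
    (hd : ∀ᶠ m : ℕ in atTop, (Module.finrank K (degSpan K x m) : ℤ) = d * m + c)
    {u : L} (hu : Transcendental K u) (hux : u ∈ degSpan K x 1) : 0 < d := by
  by_contra! hd0
  obtain ⟨m, hm, hm1⟩ := (hd.and (eventually_ge_atTop c.natAbs)).exists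
  have h1 : LinearIndependent K (fun i : Fin (m + 1) => u ^ (i : ℕ)) := by
    have := (Polynomial.basisMonomials K).linearIndependent.map' (Polynomial.aeval u).toLinearMap
      (LinearMap.ker_eq_bot.2 (transcendental_iff_injective.1 hu))
    have h2 := this.comp (fun i : Fin (m + 1) => (i : ℕ)) Fin.val_injective
    convert! h2 using 1
    ext i
    simp
  have h2 := (LinearIndependent.of_comp (degSpan K x m).subtype
    (v := fun i : Fin (m + 1) => (⟨u ^ (i : ℕ), degSpan_mono x (by omega)
      (pow_mem_degSpan hux i)⟩ : degSpan K x m)) h1).fintype_card_le_finrank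
  rw [Fintype.card_fin] at h2
  have h3 : d * m ≤ 0 := mul_nonpos_of_nonpos_of_nonneg hd0 (by positivity)
  omega

theorem isAlgebraic_adjoin_simple_of_trdeg_le_one (h : Algebra.trdeg K L ≤ 1) {u : L}
    (hu : Transcendental K u) : Algebra.IsAlgebraic (IntermediateField.adjoin K {u}) L := by
  have h1 : AlgebraicIndependent K (fun _ : Unit => u) := by
    rwa [algebraicIndependent_unique_type_iff]
  have h2 := h1.isTranscendenceBasis_of_lift_trdeg_le_of_finite (by simpa using h)
  have h3 := h2.isAlgebraic_field
  have h4 : Set.range (fun _ : Unit => u) = {u} := Set.range_const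
  rwa [h4] at h3

theorem trdeg_ratFunc {F : Type u} [Field F] : Algebra.trdeg F (RatFunc F) = 1 := by
  have := trdeg_add_eq F F[X] (A := RatFunc F)
  have h2 : Algebra.IsAlgebraic F[X] (RatFunc F) :=
    (IsFractionRing.comap_isAlgebraic_iff (K := RatFunc F)).2 inferInstance
  rw [Polynomial.trdeg_of_isDomain, trdeg_eq_zero, add_zero] at this
  exact this.symm

open IntermediateField in
/-- If `F` is perfect, then among generators of a function field of transcendence degree at most one
over `F(t)` at least one is separable over the others, unless there are fewer than three. -/
theorem exists_isSeparable_adjoin_compl {F L : Type u} [Field F] [PerfectField F] [Field L]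
    [Algebra F L] [Algebra (RatFunc F) L] [IsScalarTower F (RatFunc F) L] (x : Fin 3 → L)
    (hx : adjoin (RatFunc F) (Set.range x) = ⊤) (h : Algebra.trdeg (RatFunc F) L ≤ 1) :
    ∃ j, IsSeparable (adjoin (RatFunc F) (x '' {j}ᶜ)) (x j) := by
  have hK : Algebra.EssFiniteType F (RatFunc F) :=
    have : Algebra.EssFiniteType F[X] (RatFunc F) :=
      Algebra.EssFiniteType.of_isLocalization _ (nonZeroDivisors F[X])
    Algebra.EssFiniteType.comp F F[X] (RatFunc F)
  have hL : Algebra.EssFiniteType (RatFunc F) L := by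
    rw [← IntermediateField.fg_top_iff, ← hx]
    exact IntermediateField.fg_adjoin_of_finite (Set.finite_range x)
  have hFL : Algebra.EssFiniteType F L := Algebra.EssFiniteType.comp F (RatFunc F) L
  -- A separating transcendence basis of `L` over `F` has at most two elements, one for `t` and at
  -- most one for `L` over `F(t)`. A derivation over `F` is determined by its values on it, so three
  -- derivations cannot be independent.
  obtain ⟨s, hs, hsep⟩ := exists_isTranscendenceBasis_and_isSeparable_of_perfectField F L
  have hcard : s.card ≤ 2 := by
    have h1 := hs.cardinalMk_eq_trdeg
    rw [← trdeg_add_eq F (RatFunc F) (A := L), trdeg_ratFunc] at h1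
    have h2 : (s.card : Cardinal) ≤ 2 := by
      rw [← Cardinal.mk_coe_finset, h1, ← one_add_one_eq_two]
      gcongr
    exact_mod_cast h2
  by_contra! hj
  have hD : ∀ j, ∃ D : Derivation (RatFunc F) L L, D ≠ 0 ∧ ∀ a ∈ x '' {j}ᶜ, D a = 0 := fun j =>
    exists_derivation_ne_zero_of_adjoin _ fun h => hj j (h.isSeparable' _)
  choose D hD0 hD using hD
  have hDj : ∀ j, D j (x j) ≠ 0 := by
    intro j h0
    refine hD0 j (Derivation.ext fun a =>
      derivation_eq_zero_of_mem_adjoin (D j) (s := Set.range x) ?_ (hx ▸ mem_top))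
    rintro _ ⟨i, rfl⟩
    rcases eq_or_ne i j with rfl | hij
    · exact h0
    · exact hD j _ ⟨i, hij, rfl⟩
  -- A kernel vector `c` of `T` gives a combination of the `D j` that vanishes on `s`, hence on `L`.
  -- Its value at `x j` is `c j * D j (x j)`, so `c` is zero.
  let T : (Fin 3 → L) →ₗ[L] (s → L) := LinearMap.pi fun a =>
    Fintype.linearCombination L (fun j => D j (a : L))
  have hT : LinearMap.ker T ≠ ⊥ := LinearMap.ker_ne_bot_of_finrank_lt (by simp; omega)
  obtain ⟨c, hc, hc0⟩ := (Submodule.ne_bot_iff _).1 hT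
  refine hc0 (funext fun j => ?_)
  let Δ : Derivation F L L := ∑ j, c j • (D j).restrictScalars F
  have hΔa : ∀ a, Δ a = ∑ j, c j * D j a := by
    intro a
    simp only [Δ, Fin.sum_univ_three]
    rfl
  have hΔ : Δ (x j) = 0 := by
    refine derivation_eq_zero_of_isSeparable Δ (s := s) ?_ (hsep.isSeparable _ _)
    intro a ha
    rw [hΔa]
    have := congrFun (LinearMap.mem_ker.1 hc) ⟨a, ha⟩
    simpa [T, Fintype.linearCombination_apply] using this
  rw [hΔa, Finset.sum_eq_single j] at hΔ
  · exact (mul_eq_zero.1 hΔ).resolve_right (hDj j)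
  · intro i _ hij
    rw [hD i _ ⟨j, hij.symm, rfl⟩, mul_zero]
  · simp

end TranscendenceDegree

/-! ### Points at infinity and a Bézout inequality. -/

section Infinity

variable {K L σ : Type*} [Field K] [Field L] [Algebra K L]

/-- The value at `p` of the form of degree `n` in a polynomial. -/
noncomputable def topCoeff (p : σ → K) (n : ℕ) : MvPolynomial σ K →ₗ[K] K :=
  (Polynomial.lcoeff K n).comp
    (MvPolynomial.aeval fun i => Polynomial.C (p i) * Polynomial.X : _ →ₐ[K] K[X]).toLinearMap

theorem topCoeff_apply (p : σ → K) (n : ℕ) (g : MvPolynomial σ K) :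
    topCoeff p n g =
      (MvPolynomial.aeval (fun i => Polynomial.C (p i) * Polynomial.X) g : K[X]).coeff n := rfl

theorem natDegree_aeval_le (p : σ → K) {n : ℕ} {g : MvPolynomial σ K} (hg : g.totalDegree ≤ n) :
    (MvPolynomial.aeval (fun i => Polynomial.C (p i) * Polynomial.X) g : K[X]).natDegree ≤ n := by
  simpa using MvPolynomial.aeval_natDegree_le g hg (fun i => Polynomial.C (p i) * Polynomial.X)
    (fun i => Polynomial.natDegree_C_mul_le _ _ |>.trans Polynomial.natDegree_X_le)

theorem topCoeff_mul (p : σ → K) {m n : ℕ} {g h : MvPolynomial σ K} (hg : g.totalDegree ≤ m)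
    (hh : h.totalDegree ≤ n) : topCoeff p (m + n) (g * h) = topCoeff p m g * topCoeff p n h := by
  rw [topCoeff_apply, map_mul, Polynomial.coeff_mul_add_eq_of_natDegree_le (natDegree_aeval_le p hg)
    (natDegree_aeval_le p hh)]
  rfl

theorem topCoeff_eq_zero (p : σ → K) {n : ℕ} {g : MvPolynomial σ K} (hg : g.totalDegree < n) :
    topCoeff p n g = 0 :=
  Polynomial.coeff_eq_zero_of_natDegree_lt ((natDegree_aeval_le p le_rfl).trans_lt hg)

theorem topCoeff_X (p : σ → K) (i : σ) : topCoeff p 1 (MvPolynomial.X i) = p i := by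
  simp [topCoeff_apply]

theorem topCoeff_one (p : σ → K) : topCoeff p 0 1 = 1 := by
  simp [topCoeff_apply]

theorem topCoeff_pow (p : σ → K) {m : ℕ} {g : MvPolynomial σ K} (hg : g.totalDegree ≤ m) (n : ℕ) :
    topCoeff p (n * m) (g ^ n) = topCoeff p m g ^ n := by
  induction n with
  | zero => simp [topCoeff_one]
  | succ n ih =>
    rw [pow_succ, pow_succ, add_mul, one_mul, topCoeff_mul p _ hg, ih]
    exact (MvPolynomial.totalDegree_pow g n).trans (Nat.mul_le_mul_left n hg)

theorem topCoeff_prod {ι : Type*} (p : σ → K) (s : Finset ι) (g : ι → MvPolynomial σ K)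
    (hg : ∀ i ∈ s, (g i).totalDegree ≤ 1) :
    (∏ i ∈ s, g i).totalDegree ≤ s.card ∧
      topCoeff p s.card (∏ i ∈ s, g i) = ∏ i ∈ s, topCoeff p 1 (g i) := by
  classical
  induction s using Finset.induction_on with
  | empty => simp [topCoeff_one]
  | insert a s ha ih =>
    obtain ⟨h1, h2⟩ := ih fun i hi => hg i (Finset.mem_insert_of_mem hi)
    have h3 := hg a (Finset.mem_insert_self a s)
    rw [Finset.prod_insert ha, Finset.prod_insert ha, Finset.card_insert_of_notMem ha, add_comm]
    exact ⟨(MvPolynomial.totalDegree_mul _ _).trans (add_le_add h3 h1),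
      by rw [topCoeff_mul p h3 h1, h2]⟩

/-- The point `p` at infinity lies on the closure of the affine scheme with generic point `x`. -/
def IsAtInfinity (x : σ → L) (p : σ → K) : Prop :=
  ∀ (n : ℕ) (g : MvPolynomial σ K), g.totalDegree ≤ n → MvPolynomial.aeval x g = 0 →
    topCoeff p n g = 0

/-- Here `P` consists of polynomials of bounded degree, `f` restricts them to the curve, and `e`
imposes linear conditions that factor through the restriction. The conditions are leading values at
points at infinity in one use, and values at integral points modulo functions constant on fibres in
the other. -/
theorem finrank_add_finrank_le_of_ker_le {P W U : Type*} [AddCommGroup P] [Module K P]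
    [AddCommGroup W] [Module K W] [AddCommGroup U] [Module K U] (f : P →ₗ[K] W) (e : P →ₗ[K] U)
    [FiniteDimensional K P] (hfe : LinearMap.ker f ≤ LinearMap.ker e)
    (he : Function.Surjective e) (V : Submodule K W) (hV : ∀ w ∈ V, ∃ g, e g = 0 ∧ f g = w) :
    Module.finrank K V + Module.finrank K U ≤ Module.finrank K (LinearMap.range f) := by
  have h1 : V ≤ (LinearMap.ker e).map f := fun w hw => by
    obtain ⟨g, hg, rfl⟩ := hV w hw
    exact ⟨g, hg, rfl⟩
  have h2 : Module.finrank K V ≤ Module.finrank K ((LinearMap.ker e).map f) :=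
    Submodule.finrank_mono h1
  have h3 := LinearMap.finrank_range_add_finrank_ker (f.domRestrict (LinearMap.ker e))
  have h4 := LinearMap.finrank_range_add_finrank_ker f
  have h5 := LinearMap.finrank_range_add_finrank_ker e
  rw [LinearMap.range_eq_top.2 he, finrank_top] at h5
  rw [LinearMap.range_domRestrict, LinearMap.ker_domRestrict] at h3
  have h6 : Module.finrank K ((LinearMap.ker f).submoduleOf (LinearMap.ker e)) =
      Module.finrank K (LinearMap.ker f) :=
    LinearEquiv.finrank_eq (Submodule.submoduleOfEquivOfLe hfe)
  rw [Submodule.submoduleOf] at h6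
  omega

/-- The space `V + u V`, for `u` transcendental, is larger than `V` by at least the number of
elements of `V` that are linearly independent over `K(u)`. -/
theorem finrank_add_card_le_finrank_sup {ι : Type*} [Fintype ι] {u : L} (hu : Transcendental K u)
    (V : Submodule K L) [FiniteDimensional K V] (b : ι → L) (hbV : ∀ i, b i ∈ V)
    (hb : LinearIndependent (IntermediateField.adjoin K {u}) b) :
    Module.finrank K V + Fintype.card ι ≤
      Module.finrank K (V ⊔ V.map (LinearMap.mulLeft K u) : Submodule K L) := by
  set μ := LinearMap.mulLeft K u with hμ
  have hu0 : u ≠ 0 := fun h => hu (h ▸ isAlgebraic_zero)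
  have hμi : Function.Injective μ := mul_right_injective₀ hu0
  -- `W s` is V + uV + … + u^s V. Its dimension is concave in `s`, because `W (s + 1)` and its
  -- multiple by `u` both contain `u W s`. It is also at least `card ι * (s + 1)`, so no increment,
  -- in particular not the first, can fall below `card ι`.
  let W : ℕ → Submodule K L := fun s => (fun W => V ⊔ W.map μ)^[s] V
  have hW0 : W 0 = V := rfl
  have hWs : ∀ s, W (s + 1) = V ⊔ (W s).map μ := fun s =>
    Function.iterate_succ_apply' _ s V
  have hfd : ∀ s, FiniteDimensional K (W s) := by
    intro s
    induction s with
    | zero => exact hW0 ▸ inferInstance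
    | succ s ih => rw [hWs]; infer_instance
  have hmono : ∀ s, W s ≤ W (s + 1) := by
    intro s
    induction s with
    | zero => rw [hWs, hW0]; exact le_sup_left
    | succ s ih =>
      rw [hWs (s + 1)]
      exact (hWs s).le.trans (sup_le_sup_left (Submodule.map_mono ih) _)
  have hrank : ∀ s, Module.finrank K ((W s).map μ) = Module.finrank K (W s) := fun s =>
    (LinearEquiv.finrank_eq (Submodule.equivMapOfInjective μ hμi (W s))).symm
  have hconc : ∀ s, Module.finrank K (W (s + 2)) + Module.finrank K (W s) ≤
      2 * Module.finrank K (W (s + 1)) := by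
    intro s
    have h1 : W (s + 2) = W (s + 1) ⊔ (W (s + 1)).map μ := by
      rw [hWs (s + 1)]
      refine le_antisymm (sup_le_sup_right ?_ _) (sup_le ?_ le_sup_right)
      · rw [hWs]; exact le_sup_left
      · exact (hWs s).le.trans (sup_le_sup_left (Submodule.map_mono (hmono s)) _)
    have h2 : (W s).map μ ≤ W (s + 1) ⊓ (W (s + 1)).map μ :=
      le_inf ((hWs s).ge.trans' le_sup_right) (Submodule.map_mono (hmono s))
    have h3 := Submodule.finrank_mono h2
    have h4 := Submodule.finrank_sup_add_finrank_inf_eq (W (s + 1)) ((W (s + 1)).map μ)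
    rw [← h1, hrank] at h4
    rw [hrank] at h3
    omega
  have hlow : ∀ s, Fintype.card ι * (s + 1) ≤ Module.finrank K (W s) := by
    intro s
    have hpow : ∀ s i, i ≤ s → ∀ v ∈ V, u ^ i * v ∈ W s := by
      intro s
      induction s with
      | zero => intro i hi v hv; simpa [Nat.le_zero.1 hi, hW0] using hv
      | succ s ih =>
        intro i hi v hv
        rw [hWs]
        rcases i with _ | i
        · simpa using Submodule.mem_sup_left hv
        · refine Submodule.mem_sup_right ⟨u ^ i * v, ih i (by omega) v hv, ?_⟩
          simp [hμ, pow_succ']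
          ring
    let u' : IntermediateField.adjoin K {u} := ⟨u, IntermediateField.mem_adjoin_simple_self K u⟩
    have hu' : Transcendental K u' := by
      rwa [← transcendental_algebraMap_iff (S := IntermediateField.adjoin K {u}) (A := L)
        (algebraMap (IntermediateField.adjoin K {u}) L).injective]
    have h1 : LinearIndependent K (fun i : Fin (s + 1) => u' ^ (i : ℕ)) := by
      have := (Polynomial.basisMonomials K).linearIndependent.map'
        (Polynomial.aeval u').toLinearMap
        (LinearMap.ker_eq_bot.2 (transcendental_iff_injective.1 hu'))
      have h2 := this.comp (fun i : Fin (s + 1) => (i : ℕ)) Fin.val_injective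
      convert! h2 using 1
      ext i
      simp
    have h2 := linearIndependent_smul h1 hb
    have h3 := (LinearIndependent.of_comp (W s).subtype
      (v := fun q : Fin (s + 1) × ι => (⟨u' ^ (q.1 : ℕ) • b q.2,
        hpow s q.1 (by omega) _ (hbV q.2)⟩ : W s)) h2).fintype_card_le_finrank
    rwa [Fintype.card_prod, Fintype.card_fin, mul_comm] at h3
  by_contra! hlt
  have hlt' : Module.finrank K (W 1) + 1 ≤ Module.finrank K (W 0) + Fintype.card ι := hlt
  have hstep : ∀ s, Module.finrank K (W (s + 1)) + 1 ≤ Module.finrank K (W s) + Fintype.card ι := by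
    intro s
    induction s with
    | zero => exact hlt'
    | succ s ih =>
      have : _ + _ ≤ 2 * _ := hconc s
      rw [show s + 2 = s + 1 + 1 from rfl] at this
      omega
  have hup : ∀ s, Module.finrank K (W s) + s ≤ Module.finrank K (W 0) + s * Fintype.card ι := by
    intro s
    induction s with
    | zero => simp
    | succ s ih => have := hstep s; rw [add_mul]; omega
  -- With `s` equal to the dimension of `W 0`, the two bounds force `ι` to be empty, and then `hlt'`
  -- contradicts `W 0 ≤ W 1`.
  have h1 := hup (Module.finrank K (W 0))
  have h2 := hlow (Module.finrank K (W 0))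
  have h3 : Module.finrank K (W 0) ≤ Module.finrank K (W 1) := Submodule.finrank_mono (hmono 0)
  rw [mul_add, mul_comm, mul_one] at h2
  omega

/-- A finite family can be multiplied into the ring generated by `x`, if `x` generates `L`. -/
theorem exists_mul_mem_degSpan {ι : Type*} [Fintype ι] {x : σ → L}
    (hx : IntermediateField.adjoin K (Set.range x) = ⊤) (z : ι → L) :
    ∃ D : L, ∃ k, D ≠ 0 ∧ D ∈ degSpan K x k ∧ ∀ i, D * z i ∈ degSpan K x k := by
  classical
  have h : ∀ i, ∃ r s : MvPolynomial σ K, MvPolynomial.aeval x s ≠ 0 ∧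
      MvPolynomial.aeval x s * z i = MvPolynomial.aeval x r := by
    intro i
    obtain ⟨r, s, hrs⟩ := (IntermediateField.mem_adjoin_range_iff K x (z i)).1 (hx ▸ trivial)
    -- Division by zero yields zero, so a vanishing denominator means `z i = 0`, which is also 0/1.
    by_cases hs : MvPolynomial.aeval x s = 0
    · exact ⟨0, 1, by simp, by simp [hrs, hs]⟩
    · exact ⟨r, s, hs, by rw [hrs, mul_div_cancel₀ _ hs]⟩
  choose r s hs hrs using h
  let D := ∏ i, s i
  let E : ι → MvPolynomial σ K := fun i => (∏ j ∈ Finset.univ.erase i, s j) * r i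
  refine ⟨MvPolynomial.aeval x D, D.totalDegree ⊔ Finset.univ.sup fun i => (E i).totalDegree,
    ?_, aeval_mem_degSpan le_sup_left, fun i => ?_⟩
  · rw [map_prod]
    exact Finset.prod_ne_zero_iff.2 fun i _ => hs i
  · have : MvPolynomial.aeval x D * z i = MvPolynomial.aeval x (E i) := by
      rw [map_mul, ← hrs, ← mul_assoc, ← map_mul, Finset.prod_erase_mul _ _ (Finset.mem_univ i)]
    rw [this]
    exact aeval_mem_degSpan (le_sup_of_le_right
      (Finset.le_sup (f := fun i => (E i).totalDegree) (Finset.mem_univ i)))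

/-- The number of points at infinity with `u = 0` and the degree of the linear function `u` add up
to at most the degree. -/
theorem card_add_finrank_le [Finite σ] {x : σ → L} {d c : ℤ}
    (hx : IntermediateField.adjoin K (Set.range x) = ⊤)
    (hd : ∀ᶠ m : ℕ in atTop, (Module.finrank K (degSpan K x m) : ℤ) = d * m + c)
    (l : MvPolynomial σ K) (hl : l.totalDegree ≤ 1) (hu : Transcendental K (MvPolynomial.aeval x l))
    [FiniteDimensional (IntermediateField.adjoin K {MvPolynomial.aeval x l}) L]
    (S : Finset K) (Q : K → σ → K) (i j : σ) (hi : ∀ b ∈ S, Q b i = 1) (hj : ∀ b ∈ S, Q b j = b)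
    (hQ : ∀ b ∈ S, IsAtInfinity x (Q b)) (hlQ : ∀ b ∈ S, topCoeff (Q b) 1 l = 0) :
    (S.card + Module.finrank (IntermediateField.adjoin K {MvPolynomial.aeval x l}) L : ℤ) ≤ d := by
  classical
  set u := MvPolynomial.aeval x l
  set r := Module.finrank (IntermediateField.adjoin K {u}) L with hr
  let B := Module.finBasis (IntermediateField.adjoin K {u}) L
  obtain ⟨D, k, hD, -, hDk⟩ := exists_mul_mem_degSpan hx B
  have hB : LinearIndependent (IntermediateField.adjoin K {u}) fun i => D * B i :=
    B.linearIndependent.map' (LinearMap.mulLeft _ D)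
      (LinearMap.ker_eq_bot.2 (mul_right_injective₀ hD))
  -- With V the space for degree `n`, V + uV has dimension at least dim V + r. Its elements have
  -- representatives of degree at most `n + 1` whose leading values vanish at every `Q b`, since `l`
  -- does. Forms of degree `n + 1` take arbitrary values at the `Q b`, which adds `S.card`. The
  -- increment of the Hilbert function is eventually `d`.
  have key : ∀ n, k ≤ n → S.card ≤ n → Module.finrank K (degSpan K x n) + r + S.card ≤
      Module.finrank K (degSpan K x (n + 1)) := by
    intro n hkn hSn
    have h1 := finrank_add_card_le_finrank_sup hu (degSpan K x n) (fun i => D * B i)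
      (fun i => degSpan_mono x hkn (hDk i)) hB
    rw [Fintype.card_fin, ← hr] at h1
    let P := MvPolynomial.restrictTotalDegree σ K (n + 1)
    let f : P →ₗ[K] L := (MvPolynomial.aeval x).toLinearMap.domRestrict P
    let e : P →ₗ[K] (S → K) := (LinearMap.pi fun b : S => topCoeff (Q b) (n + 1)).domRestrict P
    have he : Function.Surjective e := by
      -- Lagrange interpolation on the points (1 : b). The power of `X i`, which has value 1 at each
      -- point, raises the degree to exactly `n + 1`.
      let g : S → MvPolynomial σ K := fun b => MvPolynomial.X i ^ (n + 2 - S.card) *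
        ∏ a ∈ S.erase b, (MvPolynomial.X j - MvPolynomial.C a * MvPolynomial.X i)
      have hlin : ∀ a : K, (MvPolynomial.X j - MvPolynomial.C a * MvPolynomial.X i :
          MvPolynomial σ K).totalDegree ≤ 1 := fun a =>
        (MvPolynomial.totalDegree_sub _ _).trans (max_le (by simp)
          ((MvPolynomial.totalDegree_mul _ _).trans (by simp)))
      have hXi : (MvPolynomial.X i ^ (n + 2 - S.card) : MvPolynomial σ K).totalDegree ≤
          (n + 2 - S.card) * 1 := by simp
      have hdeg : ∀ b : S, (n + 2 - S.card) * 1 + (S.erase b).card = n + 1 := by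
        intro b
        rw [Finset.card_erase_of_mem b.2]
        have := Finset.card_pos.2 ⟨_, b.2⟩
        omega
      have hg : ∀ b, g b ∈ P := by
        intro b
        rw [MvPolynomial.mem_restrictTotalDegree, ← hdeg b]
        exact (MvPolynomial.totalDegree_mul _ _).trans
          (add_le_add hXi (topCoeff_prod (0 : σ → K) _ _ fun a _ => hlin a).1)
      have htop : ∀ b b' : S, topCoeff (Q b') (n + 1) (g b) = ∏ a ∈ S.erase b, ((b' : K) - a) := by
        intro b b'
        obtain ⟨h1, h2⟩ := topCoeff_prod (Q b') (S.erase b)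
          (fun a => MvPolynomial.X j - MvPolynomial.C a * MvPolynomial.X i) fun a _ => hlin a
        rw [← hdeg b, topCoeff_mul _ hXi h1, h2, topCoeff_pow _ (by simp), topCoeff_X, hi _ b'.2,
          one_pow, one_mul]
        refine Finset.prod_congr rfl fun a _ => ?_
        rw [map_sub, ← MvPolynomial.smul_eq_C_mul, map_smul, topCoeff_X, topCoeff_X, hi _ b'.2,
          hj _ b'.2]
        simp
      intro v
      refine ⟨∑ b : S, (v b / ∏ a ∈ S.erase b, ((b : K) - a)) • ⟨g b, hg b⟩, ?_⟩
      ext b'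
      rw [map_sum, Finset.sum_apply, Finset.sum_eq_single b']
      · rw [map_smul, Pi.smul_apply, smul_eq_mul]
        change _ * topCoeff (Q b') (n + 1) (g b') = _
        rw [htop, div_mul_cancel₀]
        exact Finset.prod_ne_zero_iff.2 fun a ha => sub_ne_zero.2 (Finset.ne_of_mem_erase ha).symm
      · intro b _ hb
        rw [map_smul, Pi.smul_apply, smul_eq_mul]
        change _ * topCoeff (Q b') (n + 1) (g b) = _
        rw [htop, Finset.prod_eq_zero (s := S.erase b) (i := (b' : K)) (f := fun a => (b' : K) - a)
          (Finset.mem_erase.2 ⟨fun h => hb (Subtype.ext h.symm), b'.2⟩) (sub_self _), mul_zero]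
      · simp
    have h2 := finrank_add_finrank_le_of_ker_le f e ?_ he
      (degSpan K x n ⊔ (degSpan K x n).map (LinearMap.mulLeft K u)) ?_
    · have h3 : LinearMap.range f = degSpan K x (n + 1) := by
        rw [LinearMap.range_domRestrict]; rfl
      rw [h3, Module.finrank_fintype_fun_eq_card, Fintype.card_coe] at h2
      omega
    · intro g hg
      refine LinearMap.mem_ker.2 (funext fun b => hQ b b.2 _ _ ?_ (LinearMap.mem_ker.1 hg))
      exact (MvPolynomial.mem_restrictTotalDegree _ _ _).1 g.2
    · intro w hw
      obtain ⟨w1, hw1, w2, hw2, rfl⟩ := Submodule.mem_sup.1 hw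
      obtain ⟨w3, hw3, rfl⟩ := hw2
      obtain ⟨g1, hg1, rfl⟩ := mem_degSpan.1 hw1
      obtain ⟨g3, hg3, rfl⟩ := mem_degSpan.1 hw3
      refine ⟨⟨g1 + l * g3, ?_⟩, ?_, ?_⟩
      · rw [MvPolynomial.mem_restrictTotalDegree]
        refine (MvPolynomial.totalDegree_add _ _).trans (max_le (by omega) ?_)
        exact (MvPolynomial.totalDegree_mul _ _).trans (by omega)
      · ext b
        change topCoeff (Q b) (n + 1) (g1 + l * g3) = 0
        rw [map_add, topCoeff_eq_zero _ (by omega), add_comm n, topCoeff_mul _ hl hg3,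
          hlQ b b.2, zero_mul, add_zero]
      · change MvPolynomial.aeval x (g1 + l * g3) = _
        rw [map_add, map_mul]
        rfl
  obtain ⟨n, ⟨⟨h1, h2⟩, h3⟩, h4⟩ := (((hd.and ((tendsto_add_atTop_nat 1).eventually hd)).and
    (eventually_ge_atTop k)).and (eventually_ge_atTop S.card)).exists
  have h5 := key n h3 h4
  push_cast at h2
  have h6 : (Module.finrank K (degSpan K x n) : ℤ) + r + S.card ≤
      Module.finrank K (degSpan K x (n + 1)) := by exact_mod_cast h5
  rw [h1, h2] at h6
  linarith

end Infinity

/-! ### Finiteness of the projection and a conductor. -/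

section Projection

variable {K L σ : Type*} [Field K] [Field L] [Algebra K L]

/-- If the point `p` at infinity is not on the closure of the scheme with generic point `x`, then
the linear function `w` is integral over the image `y` of the projection from `p`. -/
theorem exists_pow_eq_sum {x : σ → L} {y : Fin 2 → L} {w : L} {p : σ → K}
    (l : σ → MvPolynomial (Fin 2) K) (hl : ∀ i, (l i).totalDegree ≤ 1)
    (hl0 : ∀ i, MvPolynomial.constantCoeff (l i) = 0)
    (hx : ∀ i, x i = algebraMap K L (p i) * w + MvPolynomial.aeval y (l i))
    (hp : ¬ IsAtInfinity x p) :
    ∃ n, 0 < n ∧ ∃ c : ℕ → L, (∀ i < n, c i ∈ degSpan K y (n - i)) ∧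
      w ^ n = ∑ i ∈ Finset.range n, c i * w ^ i := by
  simp only [IsAtInfinity, not_forall] at hp
  obtain ⟨n, g, hg, hg0, htop⟩ := hp
  -- Substituting p w + l(y) for x in an equation `g` of the curve gives a polynomial `G` in `w`
  -- over `K[y]`. Its coefficient at `w ^ n` is the constant `topCoeff p n g`, which is nonzero, so
  -- dividing by it gives an integral equation.
  let X' : σ → (MvPolynomial (Fin 2) K)[X] := fun i =>
    Polynomial.C (MvPolynomial.C (p i)) * Polynomial.X + Polynomial.C (l i)
  -- Total degree at most `n` in `y` and `w` together; this is what bounds the degrees of the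
  -- coefficients.
  let B : ℕ → Submodule K (MvPolynomial (Fin 2) K)[X] := fun n =>
    { carrier := {f | ∀ i, f.coeff i = 0 ∨ (f.coeff i).totalDegree + i ≤ n}
      zero_mem' := fun i => by simp
      add_mem' := fun {f g} hf hg i => by
        rcases hf i with h1 | h1
        · simpa [h1] using hg i
        · rcases hg i with h2 | h2
          · simpa [h2] using Or.inr h1
          · right
            have := MvPolynomial.totalDegree_add (f.coeff i) (g.coeff i)
            rw [Polynomial.coeff_add]
            omega
      smul_mem' := fun a f hf i => by
        rw [Polynomial.coeff_smul]
        rcases hf i with h1 | h1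
        · simp [h1]
        · exact Or.inr ((Nat.add_le_add_right (MvPolynomial.totalDegree_smul_le _ _) i).trans h1) }
  have hB : ∀ m, degSpan K X' m ≤ B m := by
    refine degSpan_le_of_mul_mem (fun m n hmn f hf i => (hf i).imp_right (·.trans hmn)) ?_ ?_
    · intro i
      rcases i with _ | i
      · simp
      · simp [Polynomial.coeff_one]
    · intro j m f hf i
      rw [show X' j * f = Polynomial.C (MvPolynomial.C (p j)) * (Polynomial.X * f) +
        Polynomial.C (l j) * f by simp only [X']; ring]
      have h1 : Polynomial.C (MvPolynomial.C (p j)) * (Polynomial.X * f) ∈ B (m + 1) := by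
        intro i
        rw [Polynomial.coeff_C_mul]
        rcases i with _ | i
        · simp
        · rw [Polynomial.coeff_X_mul]
          rcases hf i with h | h
          · simp [h]
          · right
            have := MvPolynomial.totalDegree_mul (MvPolynomial.C (p j)) (f.coeff i)
            rw [MvPolynomial.totalDegree_C] at this
            omega
      have h2 : Polynomial.C (l j) * f ∈ B (m + 1) := by
        intro i
        rw [Polynomial.coeff_C_mul]
        rcases hf i with h | h
        · simp [h]
        · right
          have := MvPolynomial.totalDegree_mul (l j) (f.coeff i)
          have := hl j
          omega
      exact (B (m + 1)).add_mem h1 h2 i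
  have hgB : MvPolynomial.aeval X' g ∈ B n := hB n (aeval_mem_degSpan hg)
  set G := MvPolynomial.aeval X' g with hG
  have hmap : G.map MvPolynomial.constantCoeff =
      (MvPolynomial.aeval (fun i => Polynomial.C (p i) * Polynomial.X) g : K[X]) := by
    have : (Polynomial.mapAlgHom (MvPolynomial.aeval (fun _ => (0 : K)) :
        MvPolynomial (Fin 2) K →ₐ[K] K)).comp (MvPolynomial.aeval X') =
        MvPolynomial.aeval (fun i => Polynomial.C (p i) * Polynomial.X) := by
      ext1 i
      simpa [X'] using hl0 i
    rw [← this]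
    have h2 : (MvPolynomial.constantCoeff : MvPolynomial (Fin 2) K →+* K) =
        (MvPolynomial.aeval (fun _ => (0 : K)) : MvPolynomial (Fin 2) K →ₐ[K] K) := by
      ext <;> simp
    rw [h2]
    rfl
  have hcoeffn : G.coeff n = MvPolynomial.C (topCoeff p n g) := by
    have h1 : (G.coeff n).totalDegree = 0 := by
      rcases hgB n with h | h
      · simp [h]
      · omega
    have h2 := (MvPolynomial.totalDegree_eq_zero_iff_eq_C).1 h1
    rw [h2, topCoeff_apply, ← hmap, Polynomial.coeff_map, MvPolynomial.constantCoeff_eq]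
  have heval : Polynomial.eval₂ (MvPolynomial.aeval y : MvPolynomial (Fin 2) K →ₐ[K] L).toRingHom w
      G = 0 := by
    rw [← hg0]
    have : (Polynomial.eval₂AlgHom (MvPolynomial.aeval y : MvPolynomial (Fin 2) K →ₐ[K] L) w
        (fun a => Commute.all _ _)).comp (MvPolynomial.aeval X') = MvPolynomial.aeval x := by
      ext1 i
      simp [X', hx]
    rw [← this]
    rfl
  have hdeg : G.natDegree < n + 1 := by
    rw [Nat.lt_succ_iff, Polynomial.natDegree_le_iff_coeff_eq_zero]
    intro i hi
    exact (hgB i).resolve_right (by omega)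
  rw [Polynomial.eval₂_eq_sum_range' _ hdeg, Finset.sum_range_succ, hcoeffn] at heval
  set t := topCoeff p n g
  have ht : algebraMap K L t ≠ 0 := by simpa using htop
  have heval' : ∑ i ∈ Finset.range n, MvPolynomial.aeval y (G.coeff i) * w ^ i +
      algebraMap K L t * w ^ n = 0 := by
    rw [← heval]
    congr 2
    exact (MvPolynomial.aeval_C y t).symm
  have hn : 0 < n := by
    by_contra! h
    obtain rfl : n = 0 := by omega
    simp [ht] at heval'
  refine ⟨n, hn, fun i => MvPolynomial.aeval y (-(MvPolynomial.C t⁻¹ * G.coeff i)), ?_, ?_⟩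
  · intro i hi
    refine aeval_mem_degSpan ?_
    rw [MvPolynomial.totalDegree_neg]
    refine (MvPolynomial.totalDegree_mul _ _).trans ?_
    rw [MvPolynomial.totalDegree_C]
    rcases hgB i with h | h
    · simp [h]
    · omega
  · refine mul_left_cancel₀ ht ?_
    rw [Finset.mul_sum, ← sub_eq_zero, ← heval', sub_eq_add_neg, ← Finset.sum_neg_distrib, add_comm]
    congr 1
    refine Finset.sum_congr rfl fun i _ => ?_
    have : algebraMap K L t * algebraMap K L t⁻¹ = 1 := by
      rw [← map_mul, mul_inv_cancel₀ htop, map_one]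
    simp only [map_neg, map_mul, MvPolynomial.aeval_C]
    linear_combination (MvPolynomial.aeval y (G.coeff i) * w ^ i) * this

/-- The filtration of the coordinate ring of a curve is, up to a shift and multiplication by a
conductor, contained in that of the image of a birational finite linear projection. -/
theorem exists_conductor {x : σ → L} {y : Fin 2 → L} {w : L} {p : σ → K}
    (l : σ → MvPolynomial (Fin 2) K) (hl : ∀ i, (l i).totalDegree ≤ 1)
    (hl0 : ∀ i, MvPolynomial.constantCoeff (l i) = 0)
    (hx : ∀ i, x i = algebraMap K L (p i) * w + MvPolynomial.aeval y (l i))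
    (hp : ¬ IsAtInfinity x p) (hy : IntermediateField.adjoin K (Set.range y) = ⊤) :
    ∃ D : L, ∃ κ : ℕ, D ≠ 0 ∧ ∀ m, ∀ z ∈ degSpan K x m, D * z ∈ degSpan K y (m + κ) := by
  obtain ⟨n, hn, c, hc, hw⟩ := exists_pow_eq_sum l hl hl0 hx hp
  obtain ⟨D, k, hD, hDk, hDw⟩ := exists_mul_mem_degSpan hy (fun _ : Unit => w)
  replace hDw := hDw ()
  -- The natural weight of the coefficient of `w ^ i` is `m - i`. The extra `n` keeps the
  -- subtraction from truncating and costs only a constant shift. Multiplication by `x j` raises `m`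
  -- by one, the integral equation replacing `w ^ n` when it appears.
  let U : ℕ → Submodule K L := fun m =>
    ⨆ i : Fin n, (degSpan K y (m + n - i)).map (LinearMap.mulLeft K (w ^ (i : ℕ)))
  have hUmem : ∀ m i, i < n → ∀ a ∈ degSpan K y (m + n - i), w ^ i * a ∈ U m := fun m i hi a ha =>
    Submodule.mem_iSup_of_mem (⟨i, hi⟩ : Fin n) ⟨a, ha, rfl⟩
  have hle : ∀ m, degSpan K x m ≤ U m := by
    refine degSpan_le_of_mul_mem ?_ ?_ ?_
    · intro m m' h
      exact iSup_mono fun i => Submodule.map_mono (degSpan_mono y (by omega))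
    · simpa using hUmem 0 0 hn 1 (one_mem_degSpan y _)
    · intro j m z hz
      have : U m ≤ (U (m + 1)).comap (LinearMap.mulLeft K (x j)) := by
        refine iSup_le fun i => ?_
        rintro _ ⟨a, ha, rfl⟩
        have hi := i.2
        change x j * (w ^ (i : ℕ) * a) ∈ U (m + 1)
        rw [hx, add_mul, mul_assoc, ← Algebra.smul_def]
        refine Submodule.add_mem _ (Submodule.smul_mem _ _ ?_) ?_
        · rw [← mul_assoc, ← pow_succ']
          rcases Nat.lt_or_ge (i + 1) n with h | h
          · exact hUmem _ _ h _ (by rwa [show m + 1 + n - (i + 1) = m + n - i by omega])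
          · rw [show (i : ℕ) + 1 = n by omega, hw, Finset.sum_mul]
            refine Submodule.sum_mem _ fun q hq => ?_
            rw [Finset.mem_range] at hq
            rw [mul_comm (c q), mul_assoc]
            refine hUmem _ _ hq _ ?_
            rw [show m + 1 + n - q = (n - q) + (m + n - i) by omega]
            exact mul_mem_degSpan (hc q hq) ha
        · rw [mul_left_comm]
          refine hUmem _ _ hi _ ?_
          rw [show m + 1 + n - i = 1 + (m + n - i) by omega]
          exact mul_mem_degSpan (aeval_mem_degSpan (hl j)) ha
      exact this hz
  -- For i < n, D^n w^i = (D w)^i D^(n - i) has degree at most `n * k` in `y`; the other `n` is the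
  -- shift in `U`.
  refine ⟨D ^ n, n * k + n, pow_ne_zero _ hD, fun m z hz => ?_⟩
  have : U m ≤ (degSpan K y (m + (n * k + n))).comap (LinearMap.mulLeft K (D ^ n)) := by
    refine iSup_le fun i => ?_
    rintro _ ⟨a, ha, rfl⟩
    have hi := i.2
    change D ^ n * (w ^ (i : ℕ) * a) ∈ degSpan K y (m + (n * k + n))
    rw [show D ^ n * (w ^ (i : ℕ) * a) = (D * w) ^ (i : ℕ) * D ^ (n - i) * a by
      rw [mul_pow, ← mul_assoc, mul_right_comm (D ^ (i : ℕ)), ← pow_add,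
        Nat.add_sub_cancel' hi.le]]
    refine degSpan_mono y ?_ (mul_mem_degSpan (mul_mem_degSpan (pow_mem_degSpan hDw i)
      (pow_mem_degSpan hDk (n - i))) ha)
    rw [← add_mul, Nat.add_sub_cancel' hi.le]
    omega
  exact this (hle m hz)

end Projection

/-! ### Plane curves and their Hilbert functions. -/

section PlaneCurve

variable {K L : Type*} [Field K] [Field L] [Algebra K L]

/-- The kernel contains a prime element `f`, and it is not maximal because `y 0` is transcendental.
A strict inclusion of `(f)` in the kernel would extend to a chain of primes of length three in a
ring of dimension two. -/
theorem isCurve_and_exists_ker_eq_span {y : Fin 2 → L} (hy : ¬ AlgebraicIndependent K y)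
    (hy0 : Transcendental K (y 0)) :
    IsCurve (RingHom.ker (MvPolynomial.aeval y : MvPolynomial (Fin 2) K →ₐ[K] L)) ∧
    ∃ f : MvPolynomial (Fin 2) K, Prime f ∧
      RingHom.ker (MvPolynomial.aeval y : MvPolynomial (Fin 2) K →ₐ[K] L) = Ideal.span {f} := by
  set C := RingHom.ker (MvPolynomial.aeval y : MvPolynomial (Fin 2) K →ₐ[K] L) with hC
  have hprime : C.IsPrime := RingHom.ker_isPrime _
  have hdim : ringKrullDim (MvPolynomial (Fin 2) K) = 2 := by
    simp [MvPolynomial.ringKrullDim_of_isNoetherianRing]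
  have hbot : C ≠ ⊥ := fun h => hy ((injective_iff_map_eq_zero _).2 fun g hg =>
    (Ideal.mem_bot (R := MvPolynomial (Fin 2) K)).1 (h ▸ hg))
  have hfield : ¬ IsField (MvPolynomial (Fin 2) K ⧸ C) := by
    intro h
    let _ := h.toField
    have h1 : Module.Finite K (MvPolynomial (Fin 2) K ⧸ C) :=
      finite_of_finite_type_of_isJacobsonRing K _
    have h2 : IsAlgebraic K (Ideal.Quotient.mkₐ K C (MvPolynomial.X 0)) :=
      Algebra.IsAlgebraic.isAlgebraic _
    have h3 := h2.algHom (Ideal.kerLiftAlg (MvPolynomial.aeval y : MvPolynomial (Fin 2) K →ₐ[K] L))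
    refine hy0 ?_
    convert! h3 using 1
    exact (MvPolynomial.aeval_X y 0).symm
  have hmax : ¬ C.IsMaximal := fun h =>
    hfield ((Ideal.Quotient.maximal_ideal_iff_isField_quotient C).1 h)
  obtain ⟨f, hfC, hf⟩ := hprime.exists_mem_prime_of_ne_bot hbot
  have hfp : (Ideal.span {f}).IsPrime := (Ideal.span_singleton_prime hf.ne_zero).2 hf
  have hle : Ideal.span {f} ≤ C := (Ideal.span_singleton_le_iff_mem C).2 hfC
  have heq : C = Ideal.span {f} := by
    by_contra hne
    have hlt : Ideal.span {f} < C := lt_of_le_of_ne hle (Ne.symm hne)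
    obtain ⟨M, hM, hCM⟩ := C.exists_le_maximal hprime.ne_top
    have hlt2 : C < M := lt_of_le_of_ne hCM fun h => hmax (h ▸ hM)
    have hMp := hM.isPrime
    have h1 := Ideal.height_add_one_le_of_lt_of_isPrime hlt
    have h2 := Ideal.height_add_one_le_of_lt_of_isPrime hlt2
    have h3 : (⊥ : Ideal (MvPolynomial (Fin 2) K)) < Ideal.span {f} := by
      rw [bot_lt_iff_ne_bot, Ne, Ideal.span_singleton_eq_bot]
      exact hf.ne_zero
    have h4 := Ideal.height_add_one_le_of_lt_of_isPrime h3
    have h5 := Ideal.height_le_ringKrullDim_of_isPrime (I := M)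
    rw [hdim] at h5
    have h6 : M.height ≤ 2 := WithBot.coe_le_coe.1 h5
    have h7 : (3 : ℕ∞) ≤ M.height := by
      refine le_trans ?_ h2
      refine le_trans ?_ (add_le_add_left h1 1)
      refine le_trans ?_ (add_le_add_left (add_le_add_left h4 1) 1)
      rw [Ideal.height_bot]
      norm_num
    exact absurd (h7.trans h6) (by norm_num)
  refine ⟨⟨hprime, le_antisymm ?_ ?_⟩, f, hf, heq⟩
  · have h1 := ringKrullDim_quotient_succ_le_of_nonZeroDivisor
      (mem_nonZeroDivisors_of_ne_zero hf.ne_zero)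
    rw [hdim, ← heq] at h1
    generalize ringKrullDim (MvPolynomial (Fin 2) K ⧸ C) = a at h1
    cases a with
    | bot => exact bot_le
    | coe a =>
      have h2 : a + 1 ≤ 1 + 1 := WithBot.coe_le_coe.1 h1
      exact_mod_cast (ENat.add_le_add_iff_right (by simp)).1 h2
  · by_contra! h
    refine hfield ?_
    have : Ring.KrullDimLE 0 (MvPolynomial (Fin 2) K ⧸ C) := by
      rw [Ring.krullDimLE_iff]
      generalize ringKrullDim (MvPolynomial (Fin 2) K ⧸ C) = a at h
      cases a with
      | bot => exact bot_le
      | coe a =>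
        have h2 : a < 1 := WithBot.coe_lt_coe.1 h
        rw [Order.lt_one_iff.1 h2]
        exact le_rfl
    exact Ring.KrullDimLE.isField_of_isDomain

/-- The multiples of `f` of degree at most `m` are `f` times the polynomials of degree at most `m -
deg f`. The dimension is thus a difference of two binomial coefficients, doubled to avoid fractions.
-/
theorem finrank_degSpan_of_ker_eq_span {y : Fin 2 → L} {f : MvPolynomial (Fin 2) K} (hf : f ≠ 0)
    (hker : RingHom.ker (MvPolynomial.aeval y : MvPolynomial (Fin 2) K →ₐ[K] L) = Ideal.span {f})
    {m : ℕ} (hm : f.totalDegree ≤ m) :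
    (Module.finrank K (degSpan K y m) : ℤ) * 2 =
      2 * f.totalDegree * m + (3 * f.totalDegree - f.totalDegree ^ 2) := by
  obtain ⟨k, rfl⟩ := Nat.exists_eq_add_of_le hm
  set δ := f.totalDegree with hδ
  let P := MvPolynomial.restrictTotalDegree (Fin 2) K (δ + k)
  let φ : P →ₗ[K] L := (MvPolynomial.aeval y).toLinearMap.domRestrict P
  let Q := MvPolynomial.restrictTotalDegree (Fin 2) K k
  have h1 := LinearMap.finrank_range_add_finrank_ker φ
  have h2 : LinearMap.range φ = degSpan K y (δ + k) := by
    rw [LinearMap.range_domRestrict]; rfl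
  have h3 : (LinearMap.ker φ).map P.subtype = Q.map (LinearMap.mulLeft K f) := by
    ext g
    constructor
    · rintro ⟨⟨g, hg⟩, hg0, rfl⟩
      have h4 : g ∈ Ideal.span {f} := hker ▸ hg0
      obtain ⟨q, rfl⟩ := Ideal.mem_span_singleton.1 h4
      refine ⟨q, ?_, rfl⟩
      rcases eq_or_ne q 0 with rfl | hq
      · exact Submodule.zero_mem _
      · have h5 := (MvPolynomial.mem_restrictTotalDegree _ _ _).1 hg
        rw [MvPolynomial.totalDegree_mul_of_isDomain hf hq] at h5
        exact (MvPolynomial.mem_restrictTotalDegree _ _ _).2 (by omega)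
    · rintro ⟨q, hq, rfl⟩
      have h5 : q.totalDegree ≤ k := (MvPolynomial.mem_restrictTotalDegree _ _ _).1 hq
      refine ⟨⟨f * q, (MvPolynomial.mem_restrictTotalDegree _ _ _).2
        ((MvPolynomial.totalDegree_mul _ _).trans (by omega))⟩, ?_, rfl⟩
      have h6 : f * q ∈ Ideal.span {f} := Ideal.mul_mem_right _ _ (Ideal.mem_span_singleton_self f)
      rw [← hker] at h6
      exact h6
  have h4 : Module.finrank K (LinearMap.ker φ) = Module.finrank K Q := by
    have e := LinearEquiv.finrank_eq
      (Submodule.equivMapOfInjective P.subtype P.injective_subtype (LinearMap.ker φ))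
    rw [h3] at e
    exact e.trans (LinearEquiv.finrank_eq (Submodule.equivMapOfInjective (LinearMap.mulLeft K f)
      (mul_right_injective₀ hf) Q)).symm
  rw [h2, h4] at h1
  have h5 := finrank_restrictTotalDegree_two K (δ + k)
  have h6 := finrank_restrictTotalDegree_two K k
  rw [← h1, add_mul, h6] at h5
  zify at h5
  push_cast
  linear_combination h5

end PlaneCurve

/-! ### Leading forms and a line that avoids the plane curve at infinity. -/

section TopForm

variable {K σ : Type*} [Field K]

open MvPolynomial

theorem homogeneousComponent_mul_of_totalDegree_le {g h : MvPolynomial σ K} {m n : ℕ}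
    (hg : g.totalDegree ≤ m) (hh : h.totalDegree ≤ n) :
    homogeneousComponent (m + n) (g * h) =
      homogeneousComponent m g * homogeneousComponent n h := by
  classical
  ext s
  rw [coeff_homogeneousComponent, MvPolynomial.coeff_mul, MvPolynomial.coeff_mul]
  split_ifs with hs
  · refine Finset.sum_congr rfl fun ⟨a, b⟩ hab => ?_
    rw [Finset.HasAntidiagonal.mem_antidiagonal] at hab
    simp only at hab
    rw [coeff_homogeneousComponent, coeff_homogeneousComponent]
    rw [← hab, map_add] at hs
    by_cases ha : MvPolynomial.coeff a g = 0
    · simp [ha]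
    by_cases hb : MvPolynomial.coeff b h = 0
    · simp [hb]
    have h1 : a.degree ≤ m := (le_totalDegree (mem_support_iff.2 ha)).trans hg
    have h2 : b.degree ≤ n := (le_totalDegree (mem_support_iff.2 hb)).trans hh
    rw [if_pos (show a.degree = m by omega), if_pos (show b.degree = n by omega)]
  · refine (Finset.sum_eq_zero fun ⟨a, b⟩ hab => ?_).symm
    rw [Finset.HasAntidiagonal.mem_antidiagonal] at hab
    simp only at hab
    rw [coeff_homogeneousComponent, coeff_homogeneousComponent]
    rw [← hab, map_add] at hs
    by_cases ha : a.degree = m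
    · rw [if_neg (show b.degree ≠ n by omega), mul_zero]
    · rw [if_neg ha, zero_mul]

theorem eq_zero_or_totalDegree_lt {g : MvPolynomial σ K} {n : ℕ} (hg : g.totalDegree ≤ n)
    (h0 : homogeneousComponent n g = 0) : g = 0 ∨ g.totalDegree < n := by
  by_contra! h
  obtain ⟨hne, hn⟩ := h
  obtain ⟨s, hs, hs'⟩ := Finset.exists_mem_eq_sup g.support (support_nonempty.2 hne)
    (fun s => s.sum fun _ e => e)
  have h1 : s.degree = n := (hs'.symm.trans (le_antisymm hg hn) : _)
  have h2 := congrArg (MvPolynomial.coeff s) h0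
  rw [coeff_homogeneousComponent, if_pos h1, MvPolynomial.coeff_zero] at h2
  exact mem_support_iff.1 hs h2

/-- If a linear form `l` does not divide the top form of `f`, then `(l ^ N, f)` contains no
polynomial of degree less than `N`, apart from the multiples of `f`. -/
theorem dvd_of_totalDegree_lt {l f s : MvPolynomial σ K} (hl : Prime l) (hl1 : l.IsHomogeneous 1)
    (hlf : ¬ l ∣ homogeneousComponent f.totalDegree f) {N : ℕ} (hs : s.totalDegree < N) (n : ℕ) :
    ∀ r q, r = 0 ∨ r.totalDegree < n → s = l ^ N * r + f * q → f ∣ r := by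
  set δ := f.totalDegree with hδ
  set F := homogeneousComponent δ f with hF
  have hF0 : F ≠ 0 := fun h => hlf (h ▸ dvd_zero l)
  have hf0 : f ≠ 0 := fun h => hF0 (by rw [hF, h, map_zero])
  have hFh : F.IsHomogeneous δ := homogeneousComponent_isHomogeneous δ f
  have hlN : (l ^ N).IsHomogeneous N := by simpa using hl1.pow N
  have hlN0 : l ^ N ≠ 0 := pow_ne_zero _ hl.ne_zero
  -- Descent on the degree of `r`. In degree `N + n` the left side vanishes, so `l ^ N * R` is minus
  -- `F` times a form. As the prime `l` does not divide `F`, `F` divides `R`, and adding a multiple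
  -- of `f` to `r` removes `R`. When `n < δ`, `R` is already zero.
  induction n with
  | zero =>
    rintro r q (rfl | h) _
    · exact dvd_zero f
    · omega
  | succ n ih =>
    intro r q hr hsrq
    have hrn : r.totalDegree ≤ n := by
      rcases hr with rfl | h
      · simp
      · omega
    set R := homogeneousComponent n r with hR
    have hlr : homogeneousComponent (N + n) (l ^ N * r) = l ^ N * R := by
      rw [homogeneousComponent_mul_of_totalDegree_le hlN.totalDegree_le hrn,
        homogeneousComponent_eq_self hlN]
    have hsum : l ^ N * R + homogeneousComponent (N + n) (f * q) = 0 := by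
      rw [← hlr, ← map_add, ← hsrq]
      exact homogeneousComponent_eq_zero _ _ (by omega)
    have hfq : (f * q).totalDegree ≤ N + n := by
      rw [show f * q = s - l ^ N * r by rw [hsrq]; ring]
      refine (totalDegree_sub _ _).trans (max_le (by omega) ((totalDegree_mul _ _).trans ?_))
      exact add_le_add hlN.totalDegree_le hrn
    obtain ⟨t, ht⟩ : ∃ t, R + F * t = 0 := by
      rcases eq_or_ne q 0 with rfl | hq
      · rw [mul_zero, map_zero, add_zero] at hsum
        exact ⟨0, by simpa using (mul_eq_zero.1 hsum).resolve_left hlN0⟩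
      · rw [totalDegree_mul_of_isDomain hf0 hq] at hfq
        obtain ⟨k, hk⟩ := Nat.exists_eq_add_of_le ((Nat.le_add_right _ _).trans hfq)
        rw [hk, homogeneousComponent_mul_of_totalDegree_le (m := δ) (n := k) le_rfl (by omega),
          ← hF] at hsum
        have h1 : l ^ N ∣ F * homogeneousComponent k q :=
          (dvd_neg.1 ⟨R, by linear_combination -hsum⟩)
        obtain ⟨t, ht⟩ := hl.pow_dvd_of_dvd_mul_left N hlf h1
        refine ⟨t, (mul_eq_zero.1 (?_ : l ^ N * (R + F * t) = 0)).resolve_left hlN0⟩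
        rw [ht] at hsum
        linear_combination hsum
    have hRn : R.totalDegree ≤ n := (homogeneousComponent_isHomogeneous n r).totalDegree_le
    rcases Nat.lt_or_ge n δ with hnδ | hnδ
    · have hR0 : R = 0 := by
        rcases eq_or_ne t 0 with rfl | ht0
        · simpa using ht
        · exfalso
          have h1 : (F * t).totalDegree ≤ n := by
            rwa [show F * t = -R by linear_combination ht, totalDegree_neg]
          rw [totalDegree_mul_of_isDomain hF0 ht0, hFh.totalDegree hF0] at h1
          omega
      exact ih r q (eq_zero_or_totalDegree_lt hrn hR0) hsrq
    · obtain ⟨k, rfl⟩ := Nat.exists_eq_add_of_le hnδ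
      have htk : t.totalDegree ≤ k := by
        rcases eq_or_ne t 0 with rfl | ht0
        · simp
        · have h1 : (F * t).totalDegree ≤ δ + k := by
            rwa [show F * t = -R by linear_combination ht, totalDegree_neg]
          rw [totalDegree_mul_of_isDomain hF0 ht0, hFh.totalDegree hF0] at h1
          omega
      have h2 : homogeneousComponent (δ + k) (F * t) = F * t := by
        rw [show F * t = -R by linear_combination ht, map_neg,
          homogeneousComponent_eq_self (homogeneousComponent_isHomogeneous _ r)]
      have h3 : homogeneousComponent (δ + k) (r + f * t) = 0 := by
        rw [map_add, ← hR, homogeneousComponent_mul_of_totalDegree_le le_rfl htk, ← hF, ← ht, ← h2,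
          homogeneousComponent_mul_of_totalDegree_le hFh.totalDegree_le htk,
          homogeneousComponent_eq_self hFh]
      have h4 : (r + f * t).totalDegree ≤ δ + k :=
        (totalDegree_add _ _).trans (max_le hrn ((totalDegree_mul _ _).trans (by omega)))
      have h5 := ih (r + f * t) (q - l ^ N * t) (eq_zero_or_totalDegree_lt h4 h3)
        (by rw [hsrq]; ring)
      exact (dvd_add_left (dvd_mul_right f t)).1 h5

/-- Over an infinite field `F` is nonzero at some `v`, and `v ≠ 0` because the degree is positive. A
nonzero linear form vanishing at `v` cannot divide `F`. -/
theorem exists_prime_linear_form [Infinite K] {F : MvPolynomial (Fin 2) K} (hF : F ≠ 0) {δ : ℕ}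
    (hδ : F.IsHomogeneous δ) (hδ0 : δ ≠ 0) :
    ∃ l : MvPolynomial (Fin 2) K, Prime l ∧ l.IsHomogeneous 1 ∧ ¬ l ∣ F := by
  obtain ⟨v, hv⟩ : ∃ v, MvPolynomial.eval v F ≠ 0 := by
    by_contra! h
    exact hF (MvPolynomial.funext fun v => by rw [h, map_zero])
  have hv0 : v ≠ 0 := by
    rintro rfl
    refine hv ?_
    have : MvPolynomial.eval (0 : Fin 2 → K) F = MvPolynomial.coeff 0 F := by
      rw [← constantCoeff_eq, ← MvPolynomial.eval_zero]
    rw [this]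
    by_contra h
    have := hδ h
    simp at this
    exact hδ0 this.symm
  let l : MvPolynomial (Fin 2) K :=
    MvPolynomial.C (v 1) * MvPolynomial.X 0 - MvPolynomial.C (v 0) * MvPolynomial.X 1
  have hl1 : l.IsHomogeneous 1 := by
    refine IsHomogeneous.sub ?_ ?_
    · simpa using (isHomogeneous_C (Fin 2) (v 1)).mul (isHomogeneous_X K (0 : Fin 2))
    · simpa using (isHomogeneous_C (Fin 2) (v 0)).mul (isHomogeneous_X K (1 : Fin 2))
  have hc0 : MvPolynomial.coeff (Finsupp.single 0 1) l = v 1 := by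
    simp [l, MvPolynomial.coeff_C_mul, MvPolynomial.coeff_X, Finsupp.single_eq_single_iff]
  have hc1 : MvPolynomial.coeff (Finsupp.single 1 1) l = -v 0 := by
    simp [l, MvPolynomial.coeff_C_mul, MvPolynomial.coeff_X, Finsupp.single_eq_single_iff]
  have hl0 : l ≠ 0 := by
    intro h
    rw [h, MvPolynomial.coeff_zero] at hc0 hc1
    refine hv0 (funext fun i => ?_)
    fin_cases i
    · simpa using hc1.symm
    · simpa using hc0.symm
  refine ⟨l, Irreducible.prime (irreducible_of_totalDegree_eq_one (hl1.totalDegree hl0) ?_), hl1,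
    ?_⟩
  · intro a ha
    by_contra h
    rw [isUnit_iff_ne_zero, not_not] at h
    subst h
    refine hl0 (MvPolynomial.ext _ _ fun i => ?_)
    simpa using zero_dvd_iff.1 (ha i)
  · rintro ⟨q, hq⟩
    refine hv ?_
    rw [hq, map_mul]
    simp only [l, map_sub, map_mul, MvPolynomial.eval_C, MvPolynomial.eval_X]
    ring

end TopForm

/-! ### The upper bound for the Hilbert function and the count of lost points. -/

section Bounds

variable {K L σ : Type*} [Field K] [Field L] [Algebra K L]

-- Take `u` to be a linear form in `y` that does not divide the leading form of `f`. Then `degSpan K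
-- x m` meets `u ^ (m + 1)` times `degSpan K x k` only in zero, and both lie in degree `k + m + 1`.
-- For large `k`, H(m) ≤ H(k + m + 1) - H(k) = d(m + 1).
open MvPolynomial in
theorem finrank_degSpan_le [Infinite K] [Finite σ] {x : σ → L} {y : Fin 2 → L} {d c : ℤ}
    (hd : ∀ᶠ m : ℕ in atTop, (Module.finrank K (degSpan K x m) : ℤ) = d * m + c)
    (hyx : ∀ i, y i ∈ degSpan K x 1) {D : L} {κ : ℕ} (hD : D ≠ 0)
    (hDκ : ∀ m, ∀ z ∈ degSpan K x m, D * z ∈ degSpan K y (m + κ))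
    {f : MvPolynomial (Fin 2) K} (hf : Prime f)
    (hker : RingHom.ker (MvPolynomial.aeval y : MvPolynomial (Fin 2) K →ₐ[K] L) = Ideal.span {f})
    (m : ℕ) :
    (Module.finrank K (degSpan K x m) : ℤ) ≤ d * (m + 1) := by
  have hmemker : ∀ g : MvPolynomial (Fin 2) K, MvPolynomial.aeval y g = 0 ↔ f ∣ g := by
    intro g
    rw [← Ideal.mem_span_singleton, ← hker, RingHom.mem_ker]
  have hδ0 : f.totalDegree ≠ 0 := by
    intro h
    have h1 := (totalDegree_eq_zero_iff_eq_C).1 h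
    refine hf.not_isUnit ?_
    rw [h1]
    refine IsUnit.map MvPolynomial.C (isUnit_iff_ne_zero.2 fun h0 => hf.ne_zero ?_)
    rw [h1, h0, map_zero]
  have hF0 : homogeneousComponent f.totalDegree f ≠ 0 := fun h =>
    (eq_zero_or_totalDegree_lt le_rfl h).elim hf.ne_zero (lt_irrefl _)
  obtain ⟨l, hl, hl1, hlf⟩ :=
    exists_prime_linear_form hF0 (homogeneousComponent_isHomogeneous _ f) hδ0
  set u := MvPolynomial.aeval y l with hu
  have hu0 : u ≠ 0 := by
    intro h
    obtain ⟨q, hq⟩ := (hmemker l).1 h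
    refine hf.not_isUnit (isUnit_of_dvd_one
      (dvd_of_totalDegree_lt (s := 0) hl hl1 hlf (N := 1) (by simp) 1 1 (-q) (by simp) ?_))
    rw [pow_one, hq]
    ring
  have hux : u ∈ degSpan K x 1 :=
    degSpan_le_degSpan hyx 1 (aeval_mem_degSpan hl1.totalDegree_le)
  have hdisj : ∀ k, ∀ h ∈ degSpan K x k, u ^ (m + 1) * h ∈ degSpan K x m → h = 0 := by
    intro k h hh hg
    -- The conductor costs `κ` in degree. Raising to the power `κ + 1` widens the gap between `m *
    -- j` and `(m + 1) * j` beyond `κ`, so `dvd_of_totalDegree_lt` applies.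
    set j := κ + 1 with hj
    obtain ⟨r, -, hr⟩ := mem_degSpan.1 (hDκ _ _ (pow_mem_degSpan hh j))
    obtain ⟨s, hs, hs'⟩ := mem_degSpan.1 (hDκ _ _ (pow_mem_degSpan hg j))
    have h1 : MvPolynomial.aeval y (s - l ^ ((m + 1) * j) * r) = 0 := by
      rw [map_sub, map_mul, map_pow, hr, hs', ← hu]
      ring
    obtain ⟨q, hq⟩ := (hmemker _).1 h1
    have h2 : f ∣ r := by
      refine dvd_of_totalDegree_lt (N := (m + 1) * j) hl hl1 hlf (hs.trans_lt ?_)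
        (r.totalDegree + 1) r q (Or.inr (Nat.lt_succ_self _)) (by linear_combination hq)
      rw [hj]
      nlinarith
    rw [(hmemker r).2 h2] at hr
    exact eq_zero_of_pow_eq_zero ((mul_eq_zero.1 hr.symm).resolve_left hD)
  obtain ⟨k, hk1, hk2⟩ := (hd.and ((tendsto_add_atTop_nat (m + 1)).eventually hd)).exists
  have hi : Function.Injective (LinearMap.mulLeft K (u ^ (m + 1))) :=
    mul_right_injective₀ (pow_ne_zero _ hu0)
  have h1 := Submodule.finrank_sup_add_finrank_inf_eq (degSpan K x m)
    ((degSpan K x k).map (LinearMap.mulLeft K (u ^ (m + 1))))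
  have h2 : degSpan K x m ⊓ (degSpan K x k).map (LinearMap.mulLeft K (u ^ (m + 1))) = ⊥ := by
    rw [Submodule.eq_bot_iff]
    rintro _ ⟨hg, h, hh, rfl⟩
    rw [hdisj k h hh hg, map_zero]
  rw [h2, finrank_bot, add_zero, ← LinearEquiv.finrank_eq
    (Submodule.equivMapOfInjective _ hi (degSpan K x k))] at h1
  have h3 : degSpan K x m ⊔ (degSpan K x k).map (LinearMap.mulLeft K (u ^ (m + 1))) ≤
      degSpan K x (k + (m + 1)) := by
    refine sup_le (degSpan_mono x (by omega)) ?_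
    rintro _ ⟨h, hh, rfl⟩
    rw [add_comm]
    refine mul_mem_degSpan ?_ hh
    simpa using pow_mem_degSpan hux (m + 1)
  have h4 := Submodule.finrank_mono h3
  rw [h1] at h4
  have h5 : (Module.finrank K (degSpan K x m) : ℤ) + Module.finrank K (degSpan K x k) ≤
      Module.finrank K (degSpan K x (k + (m + 1))) := by exact_mod_cast h4
  rw [hk1, hk2] at h5
  push_cast at h5
  linarith

open MvPolynomial in
/-- A linear projection of a curve identifies at most as many points as the difference of the
Hilbert functions. -/
theorem card_add_finrank_le_card_image_add [Finite σ] [Nonempty σ] [DecidableEq (Fin 2 → K)]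
    {x : σ → L}
    {y : Fin 2 → L} (l : Fin 2 → MvPolynomial σ K) (hl : ∀ i, (l i).totalDegree ≤ 1)
    (hy : ∀ i, y i = MvPolynomial.aeval x (l i)) (X : Finset (σ → K))
    (hX : ∀ p ∈ X, ∀ g : MvPolynomial σ K, MvPolynomial.aeval x g = 0 → MvPolynomial.eval p g = 0)
    {m : ℕ}
    (hm : X.card ≤ m) :
    X.card + Module.finrank K (degSpan K y m) ≤
      (X.image fun p i => MvPolynomial.eval p (l i)).card + Module.finrank K (degSpan K x m) := by
  classical
  let P := restrictTotalDegree σ K m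
  let φ : P →ₗ[K] L := (MvPolynomial.aeval x).toLinearMap.domRestrict P
  let e : P →ₗ[K] (X → K) :=
    (LinearMap.pi fun p : X =>
      (MvPolynomial.aeval (p : σ → K) : MvPolynomial σ K →ₐ[K] K).toLinearMap).domRestrict P
  have heval : ∀ (g : P) (p : X), e g p = MvPolynomial.eval (p : σ → K) (g : MvPolynomial σ K) := by
    intro g p
    exact congrFun (aeval_eq_eval (p : σ → K)) _
  have hφ : LinearMap.range φ = degSpan K x m := by
    rw [LinearMap.range_domRestrict]; rfl
  have hyx : ∀ i, y i ∈ degSpan K x 1 := fun i => hy i ▸ aeval_mem_degSpan (hl i)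
  have he : Function.Surjective e := by
    have hex : ∀ p p' : σ → K, p ≠ p' → ∃ i, p i ≠ p' i := fun p p' h => Function.ne_iff.1 h
    choose! i hi using hex
    let g : X → MvPolynomial σ K := fun p => ∏ q ∈ X.erase p,
      (MvPolynomial.X (i p q) - MvPolynomial.C (q (i p q)))
    have hg : ∀ p, g p ∈ P := by
      intro p
      rw [mem_restrictTotalDegree]
      refine (topCoeff_prod (0 : σ → K) _ _ fun q _ => ?_).1.trans
        ((Finset.card_le_card (Finset.erase_subset _ _)).trans hm)
      exact (totalDegree_sub _ _).trans (by simp)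
    have hgp : ∀ p : X, MvPolynomial.eval (p : σ → K) (g p) ≠ 0 := by
      intro p
      rw [map_prod, Finset.prod_ne_zero_iff]
      intro q hq
      simpa [sub_eq_zero] using hi p q (Finset.ne_of_mem_erase hq).symm
    have hgq : ∀ p q : X, p ≠ q → MvPolynomial.eval (q : σ → K) (g p) = 0 := by
      intro p q hpq
      rw [map_prod]
      refine Finset.prod_eq_zero (i := (q : σ → K))
        (Finset.mem_erase.2 ⟨fun h => hpq (Subtype.ext h.symm), q.2⟩) ?_
      simp
    intro v
    refine ⟨∑ p : X, (v p / MvPolynomial.eval (p : σ → K) (g p)) • ⟨g p, hg p⟩, ?_⟩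
    ext q
    rw [map_sum, Finset.sum_apply, Finset.sum_eq_single q]
    · rw [map_smul, Pi.smul_apply, heval, smul_eq_mul, div_mul_cancel₀ _ (hgp q)]
    · intro p _ hpq
      rw [map_smul, Pi.smul_apply, heval, hgq p q hpq, smul_zero]
    · simp
  have hφe : LinearMap.ker φ ≤ LinearMap.ker e := by
    intro g hg
    refine LinearMap.mem_ker.2 (funext fun p => ?_)
    rw [heval]
    exact hX p p.2 g hg
  let Y := X.image fun p i => MvPolynomial.eval p (l i)
  let ψ : X → Y := fun p =>
    ⟨fun i => MvPolynomial.eval (p : σ → K) (l i), Finset.mem_image_of_mem _ p.2⟩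
  -- The functions on `X` constant on the fibres of the projection. Elements of `degSpan K y m` have
  -- values in `T`, so the conditions in K^X / T, at least `X.card - Y.card` in number, vanish on
  -- them.
  let T : Submodule K (X → K) := LinearMap.range (LinearMap.funLeft K K ψ)
  have hT : Module.finrank K T ≤ Y.card := by
    refine (LinearMap.finrank_range_le _).trans ?_
    rw [Module.finrank_fintype_fun_eq_card, Fintype.card_coe]
  have heT : ∀ w ∈ degSpan K y m, ∃ g, (T.mkQ.comp e) g = 0 ∧ φ g = w := by
    intro w hw
    have hw' : w ∈ LinearMap.range φ := hφ ▸ degSpan_le_degSpan hyx m hw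
    obtain ⟨g, rfl⟩ := hw'
    refine ⟨g, ?_, rfl⟩
    rw [LinearMap.comp_apply, Submodule.mkQ_apply, Submodule.Quotient.mk_eq_zero]
    obtain ⟨g', -, hg'⟩ := mem_degSpan.1 hw
    refine ⟨fun q => MvPolynomial.eval (q : Fin 2 → K) g', ?_⟩
    ext p
    change MvPolynomial.eval (fun i => MvPolynomial.eval (p : σ → K) (l i)) g' = e g p
    rw [heval]
    have h1 : MvPolynomial.aeval x ((g : MvPolynomial σ K) - MvPolynomial.aeval l g') = 0 := by
      have h2 : (MvPolynomial.aeval x).comp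
          (MvPolynomial.aeval l : MvPolynomial (Fin 2) K →ₐ[K] MvPolynomial σ K) =
          MvPolynomial.aeval y := by
        ext1 i
        simp [hy]
      rw [map_sub, sub_eq_zero, ← AlgHom.comp_apply, h2, hg']
      rfl
    have h3 := hX p p.2 _ h1
    rw [map_sub, sub_eq_zero] at h3
    rw [h3]
    have h4 : (MvPolynomial.aeval (p : σ → K) : MvPolynomial σ K →ₐ[K] K).comp
        (MvPolynomial.aeval l) =
        MvPolynomial.aeval fun i => MvPolynomial.eval (p : σ → K) (l i) := by
      ext1 i
      simp [aeval_eq_eval]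
    have h5 := congrArg (fun τ : MvPolynomial (Fin 2) K →ₐ[K] K => τ g') h4
    simpa [aeval_eq_eval] using h5.symm
  have h1 := finrank_add_finrank_le_of_ker_le φ (T.mkQ.comp e)
    (hφe.trans (LinearMap.ker_le_ker_comp e T.mkQ)) (T.mkQ_surjective.comp he) (degSpan K y m) heT
  have h2 := T.finrank_quotient_add_finrank
  rw [hφ] at h1
  rw [Module.finrank_fintype_fun_eq_card, Fintype.card_coe] at h2
  change X.card + _ ≤ Y.card + _
  omega

end Bounds

/-! ### Function fields and birationality. -/

section FunctionField

variable {σ τ K : Type*} [Field K]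

theorem adjoin_range_coord (C : Ideal (MvPolynomial σ K)) [C.IsPrime] :
    IntermediateField.adjoin K (Set.range (coord C)) = ⊤ := by
  refine eq_top_iff.2 fun z _ => ?_
  have hmem : ∀ a : MvPolynomial σ K ⧸ C, algebraMap _ (FunctionField C) a ∈
      IntermediateField.adjoin K (Set.range (coord C)) := by
    intro a
    obtain ⟨g, rfl⟩ := Ideal.Quotient.mk_surjective a
    induction g using MvPolynomial.induction_on with
    | C a =>
      have : algebraMap (MvPolynomial σ K ⧸ C) (FunctionField C)
          (Ideal.Quotient.mk C (MvPolynomial.C a)) = algebraMap K (FunctionField C) a :=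
        (IsScalarTower.algebraMap_apply K (MvPolynomial σ K ⧸ C) (FunctionField C) a).symm
      rw [this]
      exact IntermediateField.algebraMap_mem _ a
    | add p q hp hq => rw [map_add, map_add]; exact add_mem hp hq
    | mul_X p i hp =>
      rw [map_mul, map_mul]
      exact mul_mem hp (IntermediateField.subset_adjoin K _ ⟨i, rfl⟩)
  obtain ⟨a, b, -, rfl⟩ := IsFractionRing.div_surjective (A := MvPolynomial σ K ⧸ C) z
  exact div_mem (hmem a) (hmem b)

theorem IsCurve.not_isAlgebraic {C : Ideal (MvPolynomial σ K)} (hC : IsCurve C) :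
    ¬ @Algebra.IsAlgebraic K (@FunctionField σ K _ C) _ _ _ := by
  have := hC.isPrime
  intro h
  have h1 : Algebra.IsAlgebraic K (MvPolynomial σ K ⧸ C) := ⟨fun a =>
    (isAlgebraic_algebraMap_iff
      (IsFractionRing.injective (MvPolynomial σ K ⧸ C) (FunctionField C))).1 (h.1 _)⟩
  have h2 : Algebra.IsIntegral K (MvPolynomial σ K ⧸ C) := Algebra.isAlgebraic_iff_isIntegral.1 h1
  have h3 := ringKrullDim_eq_zero_of_isField
    (isField_of_isIntegral_of_isField' (R := K) (S := MvPolynomial σ K ⧸ C) (Field.toIsField K))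
  rw [hC.dim_eq_one] at h3
  exact one_ne_zero h3

/-- Since `y` generates the function field of `C`, that field is already a fraction field of the
coordinate ring of the image, and fraction fields are unique. -/
theorem isBirationalVia_of_adjoin_eq_top [Fintype σ] (C : Ideal (MvPolynomial σ K)) [C.IsPrime]
    (M : Matrix τ σ K) (y : τ → FunctionField C) (hy : ∀ i, y i = ∑ j, M i j • coord C j)
    (htop : IntermediateField.adjoin K (Set.range y) = ⊤) :
    IsBirationalVia M C
      (RingHom.ker (MvPolynomial.aeval y : MvPolynomial τ K →ₐ[K] FunctionField C)) := by
  set φ : MvPolynomial τ K →ₐ[K] FunctionField C := MvPolynomial.aeval y with hφ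
  have hprime : (RingHom.ker φ).IsPrime := RingHom.ker_isPrime _
  let _ : Algebra (MvPolynomial τ K ⧸ RingHom.ker φ) (FunctionField C) :=
    (Ideal.kerLiftAlg φ).toRingHom.toAlgebra
  have hmap : ∀ g, algebraMap (MvPolynomial τ K ⧸ RingHom.ker φ) (FunctionField C)
      (Ideal.Quotient.mk _ g) = φ g := fun g => rfl
  have htower : IsScalarTower K (MvPolynomial τ K ⧸ RingHom.ker φ) (FunctionField C) :=
    IsScalarTower.of_algebraMap_eq fun a => ((Ideal.kerLiftAlg φ).commutes a).symm
  have hfaith : FaithfulSMul (MvPolynomial τ K ⧸ RingHom.ker φ) (FunctionField C) :=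
    (faithfulSMul_iff_algebraMap_injective _ _).2 (Ideal.kerLiftAlg_injective φ)
  have hfrac : IsFractionRing (MvPolynomial τ K ⧸ RingHom.ker φ) (FunctionField C) := by
    refine IsFractionRing.of_field _ _ fun z => ?_
    obtain ⟨r, s, hrs⟩ := (IntermediateField.mem_adjoin_range_iff K y z).1 (htop ▸ trivial)
    exact ⟨Ideal.Quotient.mk _ r, Ideal.Quotient.mk _ s, hrs⟩
  refine ⟨(FractionRing.algEquiv (MvPolynomial τ K ⧸ RingHom.ker φ)
    (FunctionField C)).restrictScalars K, fun i => ?_⟩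
  rw [← hy, coord, AlgEquiv.restrictScalars_apply, AlgEquiv.commutes, hmap, hφ,
    MvPolynomial.aeval_X]

end FunctionField

/-! ### Heights, the explicit projection and the comparison of counts. -/

section PointCount

variable {F : Type*} [Field F]

/-- Unless `q` and `r` both vanish, `l` is positive, so the value 0 of `natDegree` at zero is
harmless. -/
theorem eq_zero_or_natDegree_sub_mul_lt {a q r : F[X]} {l k : ℝ} (hk : 0 ≤ k)
    (ha : (a.natDegree : ℝ) ≤ k) (hq : q = 0 ∨ (q.natDegree : ℝ) < l)
    (hr : r = 0 ∨ (r.natDegree : ℝ) < l) :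
    q - a * r = 0 ∨ ((q - a * r).natDegree : ℝ) < l + 2 * k := by
  by_cases h : q = 0 ∧ r = 0
  · simp [h]
  right
  have hl : 0 < l := by
    rcases hq with hq | hq
    · rcases hr with hr | hr
      · exact absurd ⟨hq, hr⟩ h
      · exact (Nat.cast_nonneg _).trans_lt hr
    · exact (Nat.cast_nonneg _).trans_lt hq
  have hq' : (q.natDegree : ℝ) < l := hq.elim (fun h => by simpa [h] using hl) id
  have hr' : (r.natDegree : ℝ) < l := hr.elim (fun h => by simpa [h] using hl) id
  have h1 := (natDegree_sub_le q (a * r)).trans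
    (max_le_max_left _ (natDegree_mul_le (p := a) (q := r)))
  have h2 : ((q - a * r).natDegree : ℝ) ≤ max (q.natDegree : ℝ) (a.natDegree + r.natDegree) := by
    exact_mod_cast h1
  refine h2.trans_lt (max_lt ?_ ?_) <;> linarith

/-- With k the integer part of log_q d, there are q^(k + 1) > d polynomials of degree at most k,
each of size at most q^k ≤ d. -/
theorem exists_finset_lt_card [Fintype F] {d : ℕ} (hd : 0 < d) :
    ∃ S : Finset F[X], d < S.card ∧ ∀ b ∈ S, cardPowDegree b ≤ (d : ℤ) ∧
      (b.natDegree : ℝ) ≤ Real.logb (Fintype.card F) d := by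
  classical
  set q := Fintype.card F
  set k := Nat.log q d
  have hq : 1 < q := Fintype.one_lt_card
  have : Fintype (Polynomial.degreeLT F (k + 1)) :=
    Fintype.ofEquiv _ (Polynomial.degreeLTEquiv F (k + 1)).symm.toEquiv
  refine ⟨(Finset.univ : Finset (Polynomial.degreeLT F (k + 1))).map
    (Function.Embedding.subtype _), ?_, ?_⟩
  · rw [Finset.card_map, Finset.card_univ,
      Fintype.card_congr (Polynomial.degreeLTEquiv F (k + 1)).toEquiv, Fintype.card_fun,
      Fintype.card_fin]
    exact Nat.lt_pow_succ_log_self hq d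
  · intro b hb
    obtain ⟨⟨b, hb'⟩, -, rfl⟩ := Finset.mem_map.1 hb
    change cardPowDegree b ≤ (d : ℤ) ∧ (b.natDegree : ℝ) ≤ _
    have hdeg : b.natDegree ≤ k := by
      rcases eq_or_ne b 0 with rfl | hb0
      · simp
      · have := Polynomial.mem_degreeLT.1 hb'
        rw [Polynomial.degree_eq_natDegree hb0] at this
        exact Nat.lt_succ_iff.1 (by exact_mod_cast this)
    constructor
    · rcases eq_or_ne b 0 with rfl | hb0
      · simp
      · rw [Polynomial.cardPowDegree_nonzero b hb0]
        exact_mod_cast (Nat.pow_le_pow_right hq.le hdeg).trans (Nat.pow_log_le_self q hd.ne')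
    · exact le_trans (by exact_mod_cast hdeg) (Real.natLog_le_logb d q)

theorem sum_eq_of_perm {R : Type*} [AddCommMonoid R] (e : Equiv.Perm (Fin 3)) (f : Fin 3 → R) :
    ∑ j, f j = f (e 0) + f (e 1) + f (e 2) := by
  rw [← Equiv.sum_comp e, Fin.sum_univ_three]

/-- The matrix of the projection of `𝔸³` along the direction with coordinates `1, a, b` in the
order given by the permutation `e`. -/
def projMatrix {R : Type*} [CommRing R] (e : Equiv.Perm (Fin 3)) (a b : R) :
    Matrix (Fin 2) (Fin 3) R :=
  Matrix.of fun k i => !![-a, 1, 0; -b, 0, 1] k (e.symm i)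

/-- The vector with coordinates `1, a, b` in the order given by the permutation `e`. -/
def projCenter {R : Type*} [CommRing R] (e : Equiv.Perm (Fin 3)) (a b : R) : Fin 3 → R :=
  fun i => ![1, a, b] (e.symm i)

theorem sum_projMatrix {R V : Type*} [CommRing R] [AddCommGroup V] [Module R V]
    (e : Equiv.Perm (Fin 3)) (a b : R) (v : Fin 3 → V) (k : Fin 2) :
    ∑ j, projMatrix e a b k j • v j = ![v (e 1) - a • v (e 0), v (e 2) - b • v (e 0)] k := by
  rw [sum_eq_of_perm e]
  fin_cases k
  · simp [projMatrix, sub_eq_neg_add]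
  · simp [projMatrix, sub_eq_neg_add]

theorem map_projMatrix {R S : Type*} [CommRing R] [CommRing S] (φ : R →+* S)
    (e : Equiv.Perm (Fin 3)) (a b : R) :
    (projMatrix e a b).map φ = projMatrix e (φ a) (φ b) := by
  ext k i
  simp only [projMatrix, Matrix.map_apply, Matrix.of_apply]
  generalize e.symm i = j
  fin_cases k <;> fin_cases j <;> simp

theorem map_projCenter {R S : Type*} [CommRing R] [CommRing S] (φ : R →+* S)
    (e : Equiv.Perm (Fin 3)) (a b : R) (i : Fin 3) :
    φ (projCenter e a b i) = projCenter e (φ a) (φ b) i := by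
  simp only [projCenter]
  generalize e.symm i = j
  fin_cases j <;> simp

theorem isProjectionFrom_projMatrix (e : Equiv.Perm (Fin 3)) (a b : F[X]) :
    IsProjectionFrom (projMatrix e a b) (projCenter e a b) := by
  have hc : (fun i => algebraMap F[X] (RatFunc F) (projCenter e a b i)) =
      projCenter e (algebraMap F[X] (RatFunc F) a) (algebraMap F[X] (RatFunc F) b) :=
    funext fun i => map_projCenter (algebraMap F[X] (RatFunc F)) e a b i
  rw [IsProjectionFrom, map_projMatrix, hc]
  set a' := algebraMap F[X] (RatFunc F) a
  set b' := algebraMap F[X] (RatFunc F) b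
  ext v
  have h : ∀ k, (projMatrix e a' b').mulVecLin v k =
      ![v (e 1) - a' • v (e 0), v (e 2) - b' • v (e 0)] k := fun k => by
    rw [← sum_projMatrix]
    simp [Matrix.mulVec, dotProduct]
  rw [LinearMap.mem_ker, Submodule.mem_span_singleton]
  constructor
  · intro hv
    have h0 := (h 0).symm.trans (congrFun hv 0)
    have h1 := (h 1).symm.trans (congrFun hv 1)
    simp [sub_eq_zero] at h0 h1
    refine ⟨v (e 0), funext fun i => ?_⟩
    obtain ⟨j, rfl⟩ := e.surjective i
    fin_cases j <;> simp [projCenter, h0, h1, mul_comm]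
  · rintro ⟨t, rfl⟩
    ext k
    rw [h]
    fin_cases k <;> simp [projCenter] <;> ring

/-- The number of points lost under a projection of a curve is bounded by the loss in the Hilbert
function. -/
theorem count_le_count_add [Finite F] (C : Ideal (MvPolynomial (Fin 3) (RatFunc F))) [C.IsPrime]
    (e : Equiv.Perm (Fin 3)) (a b : F[X]) {k : ℝ} (hk : 0 ≤ k) (ha : (a.natDegree : ℝ) ≤ k)
    (hb : (b.natDegree : ℝ) ≤ k) (y : Fin 2 → FunctionField C)
    (hy : ∀ i, y i = ∑ j, (projMatrix e a b).map (algebraMap F[X] (RatFunc F)) i j • coord C j)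
    {D : ℕ} (hD : ∀ᶠ m in atTop, Module.finrank (RatFunc F) (degSpan (RatFunc F) (coord C) m) ≤
      Module.finrank (RatFunc F) (degSpan (RatFunc F) y m) + D) (l : ℝ) :
    count C l ≤ count (RingHom.ker (MvPolynomial.aeval y :
      MvPolynomial (Fin 2) (RatFunc F) →ₐ[RatFunc F] FunctionField C)) (l + 2 * k) + D := by
  classical
  set K := RatFunc F
  set C' := RingHom.ker (MvPolynomial.aeval y : MvPolynomial (Fin 2) K →ₐ[K] FunctionField C)
  set M := (projMatrix e a b).map (algebraMap F[X] K) with hM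
  let ι : ∀ {n : ℕ}, (Fin n → F[X]) → (Fin n → K) := fun v i => algebraMap F[X] K (v i)
  have hι : ∀ {n : ℕ}, Function.Injective (ι : (Fin n → F[X]) → (Fin n → K)) := by
    intro n v w h
    exact _root_.funext fun i => IsFractionRing.injective F[X] K (congrFun h i)
  let N : Fin 2 → MvPolynomial (Fin 3) K := fun i => ∑ j, M i j • MvPolynomial.X j
  have hN : ∀ i, (N i).totalDegree ≤ 1 := fun i =>
    MvPolynomial.totalDegree_finsetSum_le fun j _ =>
      (MvPolynomial.totalDegree_smul_le _ _).trans (by simp)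
  have hyN : ∀ i, y i = MvPolynomial.aeval (coord C) (N i) := fun i => by simp [hy, N]
  let π : (Fin 3 → F[X]) → (Fin 2 → F[X]) := (projMatrix e a b).mulVec
  have hπ : ∀ v, (fun i => MvPolynomial.eval (ι v) (N i)) = ι (π v) := by
    intro v
    ext i
    simp [N, ι, π, hM, Matrix.mulVec, dotProduct, MvPolynomial.smul_eval, -algebraMap_smul]
  have hfin := points_finite C l
  let X := hfin.toFinset.image ι
  have hXcard : X.card = count C l := by
    rw [Finset.card_image_of_injective _ hι, count, Set.ncard_eq_toFinset_card _ hfin]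
  have hXC : ∀ p ∈ X, ∀ g : MvPolynomial (Fin 3) K, MvPolynomial.aeval (coord C) g = 0 →
      MvPolynomial.eval p g = 0 := by
    intro p hp g hg
    obtain ⟨v, hv, rfl⟩ := Finset.mem_image.1 hp
    refine ((hfin.mem_toFinset).1 hv).1 g ?_
    rw [← ker_aeval_coord C]
    exact hg
  obtain ⟨m, hm1, hm2⟩ := (hD.and (eventually_ge_atTop X.card)).exists
  have h1 := card_add_finrank_le_card_image_add N hN hyN X hXC hm2
  have h2 : (X.image fun p i => MvPolynomial.eval p (N i)).card ≤ count C' (l + 2 * k) := by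
    have hfin' := points_finite C' (l + 2 * k)
    rw [count, Set.ncard_eq_toFinset_card _ hfin', ← Finset.card_image_of_injective _ hι]
    refine Finset.card_le_card fun p' hp' => ?_
    obtain ⟨p, hp, rfl⟩ := Finset.mem_image.1 hp'
    obtain ⟨v, hv, rfl⟩ := Finset.mem_image.1 hp
    rw [hfin.mem_toFinset] at hv
    rw [hπ]
    refine Finset.mem_image_of_mem _ (hfin'.mem_toFinset.2 ⟨fun g hg => ?_, ?_⟩)
    · change MvPolynomial.eval (ι (π v)) g = 0
      rw [← hπ]
      have h3 : MvPolynomial.aeval (coord C) (MvPolynomial.aeval N g) = 0 := by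
        have h4 : (MvPolynomial.aeval (coord C)).comp
            (MvPolynomial.aeval N : MvPolynomial (Fin 2) K →ₐ[K] MvPolynomial (Fin 3) K) =
            MvPolynomial.aeval y := by
          ext1 i
          simp [hyN]
        rw [← AlgHom.comp_apply, h4]
        exact hg
      have h5 := hXC _ hp _ h3
      have h6 : (MvPolynomial.aeval (ι v) : MvPolynomial (Fin 3) K →ₐ[K] K).comp
          (MvPolynomial.aeval N) =
          MvPolynomial.aeval fun i => MvPolynomial.eval (ι v) (N i) := by
        ext1 i
        simp [MvPolynomial.aeval_eq_eval]
      have h7 := congrArg (fun τ : MvPolynomial (Fin 2) K →ₐ[K] K => τ g) h6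
      simp only [AlgHom.comp_apply, MvPolynomial.aeval_eq_eval] at h7
      exact h7.symm.trans h5
    · rw [logHeight_lt_iff]
      have hv' := (logHeight_lt_iff v l).1 hv.2
      have hπv : ∀ i, π v i = ![v (e 1) - a • v (e 0), v (e 2) - b • v (e 0)] i := fun i => by
        rw [← sum_projMatrix]
        simp [π, Matrix.mulVec, dotProduct]
      intro i
      rw [hπv]
      fin_cases i
      · exact eq_zero_or_natDegree_sub_mul_lt hk ha (hv' _) (hv' _)
      · exact eq_zero_or_natDegree_sub_mul_lt hk hb (hv' _) (hv' _)
  have h3 : Module.finrank K (degSpan K (coord C) m) ≤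
      Module.finrank K (degSpan K y m) + D := hm1
  omega

end PointCount

/-! ### Choice of the centre of projection. -/

section Choice

universe u

open IntermediateField in
/-- A direction of projection of small height for which the projection is birational and the center
is not on the closure of the curve. -/
theorem exists_projection {F L : Type u} [Field F] [PerfectField F] [Field L] [Algebra F L]
    [Algebra (RatFunc F) L] [IsScalarTower F (RatFunc F) L] {x : Fin 3 → L}
    (hx : adjoin (RatFunc F) (Set.range x) = ⊤) (hL : ¬ Algebra.IsAlgebraic (RatFunc F) L)
    {d : ℕ} {c : ℤ} (hd : ∀ᶠ m : ℕ in atTop,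
      (Module.finrank (RatFunc F) (degSpan (RatFunc F) x m) : ℤ) = d * m + c)
    (S : Finset F[X]) (hS : d < S.card) :
    ∃ (e : Equiv.Perm (Fin 3)) (a b : F[X]), (a = 0 ∨ a = 1) ∧ b ∈ S ∧
      Transcendental (RatFunc F) (x (e 1) - algebraMap F[X] (RatFunc F) a • x (e 0)) ∧
      adjoin (RatFunc F) (Set.range ![x (e 1) - algebraMap F[X] (RatFunc F) a • x (e 0),
        x (e 2) - algebraMap F[X] (RatFunc F) b • x (e 0)]) = ⊤ ∧
      ¬ IsAtInfinity x
        (projCenter e (algebraMap F[X] (RatFunc F) a) (algebraMap F[X] (RatFunc F) b)) := by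
  classical
  set K := RatFunc F
  have htr := trdeg_le_one_of_finrank_degSpan hx hd
  obtain ⟨j, hj⟩ := exists_isSeparable_adjoin_compl x hx htr
  -- The permutation puts the separable coordinate last.
  let e : Equiv.Perm (Fin 3) := Equiv.swap 2 j
  have he2 : e 2 = j := Equiv.swap_apply_left 2 j
  have hcompl : x '' {j}ᶜ = {x (e 0), x (e 1)} := by
    have : ({j}ᶜ : Set (Fin 3)) = {e 0, e 1} := by
      ext i
      obtain ⟨k, rfl⟩ := e.surjective i
      rw [← he2]
      fin_cases k <;> simp
    rw [this, Set.image_pair]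
  rw [hcompl, ← he2] at hj
  have hrange : Set.range x = {x (e 0), x (e 1), x (e 2)} := by
    refine Set.Subset.antisymm ?_ ?_
    · rintro _ ⟨i, rfl⟩
      obtain ⟨k, rfl⟩ := e.surjective i
      fin_cases k <;> simp
    · rintro _ (rfl | rfl | rfl) <;> exact ⟨_, rfl⟩
  -- If both choices of `a` failed, `x (e 0)` and `x (e 1)` would be algebraic, hence so would `x (e
  -- 2)`, and `L` would be algebraic over `K`.
  obtain ⟨a, ha, hu⟩ : ∃ a : F[X], (a = 0 ∨ a = 1) ∧
      Transcendental K (x (e 1) - algebraMap F[X] K a • x (e 0)) := by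
    by_contra! h
    have h0 := h 0 (Or.inl rfl)
    have h1 := h 1 (Or.inr rfl)
    rw [Transcendental, not_not] at h0 h1
    simp only [map_zero, zero_smul, sub_zero, map_one, one_smul] at h0 h1
    have h2 : IsAlgebraic K (x (e 0)) := by simpa using h0.sub h1
    have h3 : Algebra.IsAlgebraic K (adjoin K {x (e 0), x (e 1)}) := by
      refine isAlgebraic_adjoin ?_
      rintro z (rfl | rfl)
      · exact h2.isIntegral
      · exact h0.isIntegral
    have h4 : IsAlgebraic K (x (e 2)) := IsAlgebraic.restrictScalars K hj.isIntegral.isAlgebraic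
    have h5 : Algebra.IsAlgebraic K (adjoin K (Set.range x)) := by
      refine isAlgebraic_adjoin ?_
      rw [hrange]
      rintro z (rfl | rfl | rfl)
      · exact h2.isIntegral
      · exact h0.isIntegral
      · exact h4.isIntegral
    rw [hx] at h5
    exact hL ((AlgEquiv.isAlgebraic_iff topEquiv).1 h5)
  set α := algebraMap F[X] K a
  let l : MvPolynomial (Fin 3) K := MvPolynomial.X (e 1) - MvPolynomial.C α * MvPolynomial.X (e 0)
  have hl : l.totalDegree ≤ 1 := (MvPolynomial.totalDegree_sub _ _).trans
    (max_le (by simp) ((MvPolynomial.totalDegree_mul _ _).trans (by simp)))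
  set u := x (e 1) - α • x (e 0) with hu_def
  have hlu : MvPolynomial.aeval x l = u := by simp [l, hu_def, Algebra.smul_def]
  let E := adjoin K {u}
  have halg : Algebra.IsAlgebraic E L := isAlgebraic_adjoin_simple_of_trdeg_le_one htr hu
  have hess : Algebra.EssFiniteType E L := by
    have : Algebra.EssFiniteType K L := by
      rw [← IntermediateField.fg_top_iff, ← hx]
      exact IntermediateField.fg_adjoin_of_finite (Set.finite_range x)
    exact Algebra.EssFiniteType.of_comp K E L
  have hfd : FiniteDimensional E L := Algebra.finite_of_essFiniteType_of_isAlgebraic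
  have huE : u ∈ (adjoin K ({u} ∪ {x (e 0)} : Set L)) := subset_adjoin K _ (Or.inl rfl)
  have hle : adjoin K {x (e 0), x (e 1)} ≤ (adjoin E {x (e 0)}).restrictScalars K := by
    rw [adjoin_adjoin_left, adjoin_le_iff]
    have h0 : x (e 0) ∈ adjoin K ({u} ∪ {x (e 0)} : Set L) := subset_adjoin K _ (Or.inr rfl)
    rintro z (rfl | rfl)
    · exact h0
    · have := add_mem huE (IntermediateField.smul_mem _ h0 (x := α))
      simpa [hu_def] using this
  have hsep : IsSeparable (adjoin E {x (e 0)}) (x (e 2)) := by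
    let _ : Algebra (adjoin K {x (e 0), x (e 1)}) (adjoin E {x (e 0)}) :=
      (inclusion hle).toRingHom.toAlgebra
    have : IsScalarTower (adjoin K {x (e 0), x (e 1)}) (adjoin E {x (e 0)}) L :=
      IsScalarTower.of_algebraMap_eq fun _ => rfl
    exact IsSeparable.tower_top _ hj
  have htopE : adjoin E {x (e 0), x (e 2)} = ⊤ := by
    rw [← restrictScalars_eq_top_iff (K := K), eq_top_iff, ← hx, adjoin_adjoin_left, adjoin_le_iff,
      hrange]
    have hmem : u ∈ adjoin K ({u} ∪ {x (e 0), x (e 2)} : Set L) :=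
      subset_adjoin K _ (Or.inl rfl)
    have h0 : x (e 0) ∈ adjoin K ({u} ∪ {x (e 0), x (e 2)} : Set L) :=
      subset_adjoin K _ (Or.inr (Or.inl rfl))
    rintro z (rfl | rfl | rfl)
    · exact h0
    · have := add_mem hmem (IntermediateField.smul_mem _ h0 (x := α))
      simpa [hu_def] using this
    · exact subset_adjoin K _ (Or.inr (Or.inr rfl))
  let β : F[X] → K := algebraMap F[X] K
  have hβ : Function.Injective β := IsFractionRing.injective F[X] K
  have hβE : Function.Injective fun b : F[X] => algebraMap K E (β b) :=
    (algebraMap K E).injective.comp hβ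
  -- The two kinds of bad `b`: the projection is not birational, or its centre lies on the closure.
  -- With r = [L : E], they number at most r and d - r, fewer together than `S`. The second bound
  -- applies because the form `l` vanishes at every centre, whatever `b` is.
  let S₁ := S.filter fun b =>
    adjoin E {x (e 2) - algebraMap E L (algebraMap K E (β b)) * x (e 0)} ≠ ⊤
  let S₂ := S.filter fun b => IsAtInfinity x (projCenter e α (β b))
  have hS₁ : S₁.card ≤ Module.finrank E L := by
    rw [← Finset.card_image_of_injective S₁ hβE]
    refine card_le_finrank_of_adjoin_ne_top (x (e 0)) (x (e 2)) htopE hsep _ fun b hb => ?_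
    obtain ⟨b', hb', rfl⟩ := Finset.mem_image.1 hb
    exact (Finset.mem_filter.1 hb').2
  have hS₂ : (S₂.card + Module.finrank E L : ℤ) ≤ d := by
    have hfd' : FiniteDimensional (adjoin K {MvPolynomial.aeval x l}) L := by rw [hlu]; exact hfd
    have h1 := card_add_finrank_le hx hd l hl (by rw [hlu]; exact hu) (S₂.image β)
      (fun b => projCenter e α b) (e 0) (e 2) (fun b _ => by simp [projCenter])
      (fun b _ => by simp [projCenter]) (fun b hb => ?_) (fun b _ => ?_)
    · rw [Finset.card_image_of_injective _ hβ, hlu] at h1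
      exact h1
    · obtain ⟨b', hb', rfl⟩ := Finset.mem_image.1 hb
      exact (Finset.mem_filter.1 hb').2
    · rw [map_sub, ← MvPolynomial.smul_eq_C_mul, map_smul, topCoeff_X, topCoeff_X]
      simp [projCenter]
  obtain ⟨b, hbS, hb⟩ : ∃ b ∈ S, b ∉ S₁ ∪ S₂ := by
    by_contra! h
    have h1 := Finset.card_le_card (show S ⊆ S₁ ∪ S₂ from h)
    have h2 := Finset.card_union_le S₁ S₂
    omega
  rw [Finset.mem_union, not_or, Finset.mem_filter, Finset.mem_filter] at hb
  obtain ⟨hb1, hb2⟩ := hb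
  have hb3 : adjoin E {x (e 2) - algebraMap E L (algebraMap K E (β b)) * x (e 0)} = ⊤ := by
    by_contra h
    exact hb1 ⟨hbS, h⟩
  refine ⟨e, a, b, ha, hbS, hu, ?_, fun h => hb2 ⟨hbS, h⟩⟩
  rw [← restrictScalars_eq_top_iff (K := K), adjoin_adjoin_left] at hb3
  rw [← hb3, Matrix.range_cons, Matrix.range_cons, Matrix.range_empty, Set.union_empty,
    ← IsScalarTower.algebraMap_apply, ← Algebra.smul_def]

end Choice

/-! ### Positivity and invariance of the degree. -/

section Degree

variable {K L σ : Type*} [Field K] [Field L] [Algebra K L]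

theorem pos_of_finrank_degSpan_of_not_isAlgebraic [Finite σ] {x : σ → L}
    (hx : IntermediateField.adjoin K (Set.range x) = ⊤) (hL : ¬ Algebra.IsAlgebraic K L) {d : ℕ}
    {c : ℤ} (hd : ∀ᶠ m : ℕ in atTop, (Module.finrank K (degSpan K x m) : ℤ) = d * m + c) :
    0 < d := by
  obtain ⟨i, hi⟩ : ∃ i, Transcendental K (x i) := by
    by_contra! h
    have h5 : Algebra.IsAlgebraic K (IntermediateField.adjoin K (Set.range x)) := by
      refine IntermediateField.isAlgebraic_adjoin ?_
      rintro _ ⟨i, rfl⟩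
      exact (not_not.1 (h i)).isIntegral
    rw [hx] at h5
    exact hL ((AlgEquiv.isAlgebraic_iff IntermediateField.topEquiv).1 h5)
  exact_mod_cast pos_of_finrank_degSpan hd hi (apply_mem_degSpan x i)

/-- The Hilbert function of `x` at `m` lies between those of `y` at `m` and at `m + κ`. All are
eventually linear, so the slopes agree. -/
theorem totalDegree_eq_of_finrank_degSpan [Finite σ] {x : σ → L} {y : Fin 2 → L} {d : ℕ} {c : ℤ}
    (hd : ∀ᶠ m : ℕ in atTop, (Module.finrank K (degSpan K x m) : ℤ) = d * m + c)
    (hyx : ∀ i, y i ∈ degSpan K x 1) {D : L} {κ : ℕ} (hD : D ≠ 0)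
    (hDκ : ∀ m, ∀ z ∈ degSpan K x m, D * z ∈ degSpan K y (m + κ))
    {f : MvPolynomial (Fin 2) K} (hf : f ≠ 0)
    (hker : RingHom.ker (MvPolynomial.aeval y : MvPolynomial (Fin 2) K →ₐ[K] L) = Ideal.span {f}) :
    f.totalDegree = d := by
  have hle : ∀ m, Module.finrank K (degSpan K y m) ≤ Module.finrank K (degSpan K x m) := fun m =>
    Submodule.finrank_mono (degSpan_le_degSpan hyx m)
  have hge : ∀ m, Module.finrank K (degSpan K x m) ≤
      Module.finrank K (degSpan K y (m + κ)) := by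
    intro m
    rw [LinearEquiv.finrank_eq (Submodule.equivMapOfInjective
      (LinearMap.mulLeft K D) (mul_right_injective₀ hD) (degSpan K x m))]
    refine Submodule.finrank_mono ?_
    rintro _ ⟨z, hz, rfl⟩
    exact hDκ m z hz
  have hform {m} (hm : f.totalDegree ≤ m) := finrank_degSpan_of_ker_eq_span (m := m) hf hker hm
  generalize f.totalDegree = δ at hform ⊢
  obtain ⟨m, ⟨hm1, hm2⟩, hm3⟩ := ((hd.and (eventually_ge_atTop δ)).and
    (eventually_ge_atTop (2 * c.natAbs + δ ^ 2 + 3 * δ + 2 * δ * κ + 1))).exists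
  have h1 := Int.ofNat_le.2 (hle m)
  have h2 := Int.ofNat_le.2 (hge m)
  have h3 := hform hm2
  have h4 := hform (hm2.trans (Nat.le_add_right m κ))
  rw [hm1] at h1 h2
  have h5 : (2 * |c| + δ ^ 2 + 3 * δ + 2 * δ * κ + 1 : ℤ) ≤ m := by
    rw [← Int.natCast_natAbs]
    exact_mod_cast hm3
  have h6 := le_abs_self c
  have h7 := neg_abs_le c
  push_cast at h4
  have h8 : (0 : ℤ) ≤ δ * κ := by positivity
  have h9 : (0 : ℤ) ≤ δ := by positivity
  refine le_antisymm ?_ ?_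
  · by_contra! hlt
    have h10 : (d : ℤ) + 1 ≤ δ := by exact_mod_cast hlt
    nlinarith
  · by_contra! hlt
    have h10 : (δ : ℤ) + 1 ≤ d := by exact_mod_cast hlt
    nlinarith

end Degree

end AffineCurve

/-! ### Conclusion of the proof. -/

theorem lemma4p1 {F : Type*} [Field F] [Fintype F]
    (C : Ideal (MvPolynomial (Fin 3) (RatFunc F))) (hC : AffineCurve.IsCurve C)
    (d : ℕ) (hd : AffineCurve.HasDegree C d) :
    ∃ C' : Ideal (MvPolynomial (Fin 2) (RatFunc F)),
      AffineCurve.IsCurve C' ∧ AffineCurve.HasDegree C' d ∧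
      (∃ (p : Fin 3 → F[X]) (M : Matrix (Fin 2) (Fin 3) F[X]),
        Ideal.span (Set.range p) = ⊤ ∧ (∀ i, cardPowDegree (p i) ≤ (d : ℤ)) ∧
        AffineCurve.IsProjectionFrom M p ∧
        AffineCurve.IsBirationalVia (M.map (algebraMap F[X] (RatFunc F))) C C') ∧
      ∀ ℓ : ℝ, AffineCurve.count C ℓ ≤
        AffineCurve.count C' (ℓ + 2 * Real.logb (Fintype.card F) d) + d ^ 2 := by
  open AffineCurve in
  have := hC.isPrime
  obtain ⟨c, hc⟩ := hd
  set x := coord C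
  have hx := adjoin_range_coord C
  have hL := hC.not_isAlgebraic
  have hfin : ∀ᶠ m : ℕ in atTop,
      (Module.finrank (RatFunc F) (degSpan (RatFunc F) x m) : ℤ) = d * m + c := by
    simpa only [hilbertFunction_eq_finrank] using hc
  have hd0 : 0 < d := pos_of_finrank_degSpan_of_not_isAlgebraic hx hL hfin
  obtain ⟨S, hSd, hS⟩ := exists_finset_lt_card (F := F) hd0
  obtain ⟨e, a, b, ha, hbS, hu, htop, hinf⟩ := exists_projection hx hL hfin S hSd
  obtain ⟨hbd, hblog⟩ := hS b hbS
  have hlog : 0 ≤ Real.logb (Fintype.card F) d :=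
    Real.logb_nonneg (by exact_mod_cast Fintype.one_lt_card) (by exact_mod_cast hd0)
  set α := algebraMap F[X] (RatFunc F) a
  set β := algebraMap F[X] (RatFunc F) b
  set y : Fin 2 → FunctionField C := ![x (e 1) - α • x (e 0), x (e 2) - β • x (e 0)] with hy
  have hyM : ∀ i, y i =
      ∑ j, (projMatrix e a b).map (algebraMap F[X] (RatFunc F)) i j • coord C j := by
    intro i
    rw [map_projMatrix, sum_projMatrix]
  have hyx : ∀ i, y i ∈ degSpan (RatFunc F) x 1 := fun i => by
    rw [hyM]
    exact Submodule.sum_mem _ fun j _ => Submodule.smul_mem _ _ (apply_mem_degSpan x j)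
  -- With w = x (e 0), the coordinates are w, a w + y₀ and b w + y₁, that is p w plus a linear form
  -- in y.
  obtain ⟨D, κ, hD, hDκ⟩ := exists_conductor (x := x) (y := y) (w := x (e 0))
    (p := projCenter e α β) (fun i => ![0, MvPolynomial.X 0, MvPolynomial.X 1] (e.symm i))
    (fun i => by generalize e.symm i = j; fin_cases j <;> simp)
    (fun i => by generalize e.symm i = j; fin_cases j <;> simp)
    (fun i => by
      obtain ⟨j, rfl⟩ := e.surjective i
      fin_cases j <;> simp [projCenter, hy, Algebra.smul_def])
    hinf htop
  obtain ⟨hC', f, hf, hker⟩ := isCurve_and_exists_ker_eq_span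
    (not_algebraicIndependent_of_finrank_degSpan hfin y hyx) (y := y) hu
  have hdeg := totalDegree_eq_of_finrank_degSpan hfin hyx hD hDκ hf.ne_zero hker
  have hform' : ∀ {m}, d ≤ m → (Module.finrank (RatFunc F) (degSpan (RatFunc F) y m) : ℤ) * 2 =
      2 * d * m + (3 * d - d ^ 2) := fun {m} hm => by
    have := finrank_degSpan_of_ker_eq_span hf.ne_zero hker (hdeg.trans_le hm)
    rwa [hdeg] at this
  refine ⟨_, hC', ?_, ⟨projCenter e a b, projMatrix e a b, ?_, ?_,
    isProjectionFrom_projMatrix e a b, isBirationalVia_of_adjoin_eq_top C _ y hyM htop⟩, ?_⟩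
  · refine ⟨(3 * d - d ^ 2) / 2, ?_⟩
    -- The parity needed for an integral constant term is read off from the doubled formula at `m =
    -- d`.
    have heven : 2 ∣ (3 * d - d ^ 2 : ℤ) := by
      have := hform' (le_refl d)
      exact ⟨Module.finrank (RatFunc F) (degSpan (RatFunc F) y d) - d ^ 2,
        by linear_combination -this⟩
    filter_upwards [eventually_ge_atTop d] with m hm
    rw [hilbertFunction_ker_aeval]
    have h1 : (Module.finrank (RatFunc F) (degSpan (RatFunc F) y m) : ℤ) * 2 =
        2 * (d * m) + (3 * d - d ^ 2) := by linear_combination hform' hm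
    omega
  · rw [Ideal.eq_top_iff_one]
    refine Ideal.subset_span ⟨e 0, ?_⟩
    simp [projCenter]
  · intro i
    obtain ⟨j, rfl⟩ := e.surjective i
    have h1 : (1 : ℤ) ≤ d := by exact_mod_cast hd0
    fin_cases j
    · simpa [projCenter] using h1
    · rcases ha with rfl | rfl
      · simp [projCenter]
      · simpa [projCenter] using h1
    · simpa [projCenter] using hbd
  · intro ℓ
    refine count_le_count_add C e a b hlog ?_ hblog y hyM ?_ ℓ
    · rcases ha with rfl | rfl <;> simpa using hlog
    · filter_upwards [eventually_ge_atTop d] with m hm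
      have : Infinite (RatFunc F) :=
        Infinite.of_injective _ (IsFractionRing.injective F[X] (RatFunc F))
      -- The difference of Hilbert functions is at most d(m + 1) - dm - (3d - d²)/2 = d(d - 1)/2,
      -- which is below d².
      have h1 := finrank_degSpan_le hfin hyx hD hDκ hf hker m
      have h2 := hform' hm
      have h3 : (d : ℤ) ≤ d ^ 2 := by exact_mod_cast Nat.le_self_pow two_ne_zero d
      have h4 : (Module.finrank (RatFunc F) (degSpan (RatFunc F) x m) : ℤ) ≤
          (Module.finrank (RatFunc F) (degSpan (RatFunc F) y m) + d ^ 2 : ℕ) := by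
        rw [Nat.cast_add, Nat.cast_pow]
        generalize (Module.finrank (RatFunc F) (degSpan (RatFunc F) x m) : ℤ) = A at h1
        generalize (Module.finrank (RatFunc F) (degSpan (RatFunc F) y m) : ℤ) = B at h2
        nlinarith
      exact Int.ofNat_le.1 h4
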